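/- Consider hard-core bosons on the lattice $\mathbb Z$: the hard-core Fock space has the orthonormal basis $|X\rangle=\prod_{x\in X}b^*(x)|0\rangle$, $X\subset\mathbb Z$ finite; $a(x)|X\rangle=|X\setminus\{x\}\rangle$ if $x\in X$ and $a(x)|X\rangle=0$ otherwise; and $\mathfrak A$ is the C*-algebra generated by the $a(x)$, $x\in\mathbb Z$. Let $c(x)=e^{-i\pi\sum_{j\le x-1}a^*(j)a(j)}a(x)$ be the fermionic operators given by the Jordan–Wigner transformation (the products $c^*(x)c(y)$ lie in $\mathfrak A$), and let $\alpha_s$ be the Heisenberg evolution of the nearest-neighbour Hamiltonian $$H=-\tfrac12\sum_{x}a^*(x)(\Delta a)(x),\qquad (\Delta a)(x)=a(x+1)+a(x-1)-2a(x),$$ that is, $\alpha_s(A)=\lim_{N\to\infty}e^{isH_N}Ae^{-isH_N}$ in norm, where $H_N$ is the Hamiltonian of the box $[-N,N]$ with empty boundary conditions. For a state $\nu$ on $\mathfrak A$ and $\varepsilon>0$, let $\nu[n(\varepsilon^{-1}r,k)]$ be the distribution $$\nu[n(\varepsilon^{-1}r,k)]=\sum_{\eta\in\frac12\mathbb Z}e^{2i\eta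 k}\,\nu\big[c^*(\lfloor\varepsilon^{-1}r+\eta\rfloor)\,c(\lfloor\varepsilon^{-1}r-\eta\rfloor)\big]$$ in $(r,k)\in\mathbb R^2$, which is $2\pi$-periodic in $k$ (the series converges in the sense of distributions). Let $(\omega^\varepsilon)_{\varepsilon>0}$ be a family of states on $\mathfrak A$ such that the limit $$f(r,k)=\lim_{\varepsilon\downarrow0}\omega^\varepsilon[n(\varepsilon^{-1}r,k)]$$ exists weakly, i.e. after integration against each $\varphi\in C_c^\infty(\mathbb R^2)$. Then: 1. the norm limit $\alpha_s(c^*(x)c(y))$ exists for all $s\in\mathbb R$ and $x,y\in\mathbb Z$; 2. there are distributions $f(\cdot,\cdot\,;t)$, $t\in\mathbb R$, on $\mathbb R^2$ such that $f(\cdot,\cdot\,;0)=f$ and, for every $t\in\mathbb R$, weakly, $$f(r,k;t)=\lim_{\varepsilon\downarrow0}(\omega^\varepsilon\circ\alpha_{\varepsilon^{-1}t})[n(\varepsilon^{-1}r,k)];$$ 3. they satisfy the free-force Euler equation $$\partial_t f(r,k;t)+\sin k\;\partial_r f(r,k;t)=0,$$ in the sense that $t\mapsto\langle f(\cdot,\cdot\,;t),\varphi\rangle$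 is differentiable with derivative $\langle f(\cdot,\cdot\,;t),\sin k\,\partial_r\varphi\rangle$ at every $t\in\mathbb R$, for every $\varphi\in C_c^\infty(\mathbb R^2)$; 4. if $f$ is a locally integrable function, then $f(\cdot,\cdot\,;t)$ is a locally integrable function for every $t$; if moreover $f$ is $C^1$, then these functions can be chosen to form a $C^1$ function of $(t,r,k)\in\mathbb R^3$ that takes the value $f(r,k)$ at $t=0$ and satisfies the Euler equation at every point. -/

import Mathlib

open Filter Topology MeasureTheory
open scoped Distributions LineDeriv

noncomputable section

namespace HardCore

/-- The hard-core Bose Fock space over the lattice `ℤ`: it has the orthonormal basis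
`|X⟩ = ∏_{x ∈ X} b*(x) |0⟩`, indexed by the finite subsets `X` of `ℤ` (the occupied sites). -/
abbrev Fock : Type := lp (fun _ : Finset ℤ => ℂ) 2

theorem weighted_sum_le (w : Finset ℤ → ℂ) (s : Finset ℤ → Finset ℤ)
    (hw : ∀ X, ‖w X‖ ≤ 1) (hs : Set.InjOn s {X | w X ≠ 0}) (f : Fock)
    (S : Finset (Finset ℤ)) :
    ∑ X ∈ S, ‖w X * f (s X)‖ ^ (2 : ENNReal).toReal ≤ ‖f‖ ^ (2 : ENNReal).toReal := by
  classical
  calc ∑ X ∈ S, ‖w X * f (s X)‖ ^ (2 : ENNReal).toReal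
      = ∑ X ∈ S with w X ≠ 0, ‖w X * f (s X)‖ ^ (2 : ENNReal).toReal := by
        rw [Finset.sum_filter]
        refine Finset.sum_congr rfl fun X _ => ?_
        by_cases h : w X = 0 <;> simp [h]
    _ ≤ ∑ X ∈ S with w X ≠ 0, ‖f (s X)‖ ^ (2 : ENNReal).toReal := by
        refine Finset.sum_le_sum fun X _ => ?_
        refine Real.rpow_le_rpow (norm_nonneg _) ?_ (by simp)
        rw [norm_mul]
        exact mul_le_of_le_one_left (norm_nonneg _) (hw X)
    _ = ∑ Y ∈ (S.filter fun X => w X ≠ 0).image s, ‖f Y‖ ^ (2 : ENNReal).toReal := by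
        rw [Finset.sum_image]
        intro X hX Y hY h
        exact hs (by simpa using (Finset.mem_filter.mp hX).2)
          (by simpa using (Finset.mem_filter.mp hY).2) h
    _ ≤ ‖f‖ ^ (2 : ENNReal).toReal := lp.sum_rpow_le_norm_rpow (by simp) f _

/-- The bounded operator `(T f)(X) = w X * f (s X)` on Fock space, for a weight `w` bounded by one
and a map `s` of configurations that is injective where `w` does not vanish. -/
def weighted (w : Finset ℤ → ℂ) (s : Finset ℤ → Finset ℤ)
    (hw : ∀ X, ‖w X‖ ≤ 1) (hs : Set.InjOn s {X | w X ≠ 0}) : Fock →L[ℂ] Fock :=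
  LinearMap.mkContinuous
    { toFun := fun f => ⟨fun X => w X * f (s X), memℓp_gen' (weighted_sum_le w s hw hs f)⟩
      map_add' := fun f g => by
        refine lp.ext (funext fun X => ?_)
        exact mul_add (w X) (f (s X)) (g (s X))
      map_smul' := fun c f => by
        refine lp.ext (funext fun X => ?_)
        exact mul_left_comm (w X) c (f (s X)) }
    1 (fun f => by
      rw [one_mul]
      exact lp.norm_le_of_forall_sum_le (by simp) (norm_nonneg _)
        (weighted_sum_le w s hw hs f))

theorem weighted_apply (w : Finset ℤ → ℂ) (s : Finset ℤ → Finset ℤ)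
    (hw : ∀ X, ‖w X‖ ≤ 1) (hs : Set.InjOn s {X | w X ≠ 0}) (f : Fock) (X : Finset ℤ) :
    weighted w s hw hs f X = w X * f (s X) := rfl

/-- The hard-core boson annihilation operator `a(x) = P b(x) P`: it maps `|X⟩` to `|X \ {x}⟩` if
`x ∈ X`, and to `0` otherwise. On coordinates, `(a(x) f)(X) = f(X ∪ {x})` if `x ∉ X`, and `0`
otherwise. The creation operator `a*(x)` is its adjoint `star (annih x)`. -/
def annih (x : ℤ) : Fock →L[ℂ] Fock :=
  weighted (fun X => if x ∈ X then 0 else 1) (fun X => insert x X)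
    (fun X => by split_ifs <;> simp)
    (fun X hX Y hY h => by
      have hX' : x ∉ X := by simpa using hX
      have hY' : x ∉ Y := by simpa using hY
      have h' : insert x X = insert x Y := h
      rw [← Finset.erase_insert hX', h', Finset.erase_insert hY'])

/-- The Jordan–Wigner string `exp (-iπ ∑_{j ≤ x - 1} a*(j) a(j))`, which multiplies `|X⟩` by
`(-1)` to the number of occupied sites to the left of `x`. -/
def jwString (x : ℤ) : Fock →L[ℂ] Fock :=
  weighted (fun X => (-1) ^ (X.filter (· < x)).card) id (fun X => by simp)
    (Function.injective_id.injOn)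

/-- The fermionic annihilation operator `c(x) = exp (-iπ ∑_{j ≤ x - 1} a*(j) a(j)) a(x)`
given by the Jordan–Wigner transformation; `c*(x)` is `star (fermi x)`. -/
def fermi (x : ℤ) : Fock →L[ℂ] Fock := jwString x * annih x

/-- The C*-algebra of observables of hard-core bosons on `ℤ`: the norm closure of the unital
*-algebra that is generated by the operators `a(x)`, `x ∈ ℤ`. -/
def observables : StarSubalgebra ℂ (Fock →L[ℂ] Fock) :=
  (StarAlgebra.adjoin ℂ (Set.range annih)).topologicalClosure

/-- The C*-algebra of observables, as a type. -/
abbrev Obs : Type := observables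

theorem annih_mem (x : ℤ) : annih x ∈ observables :=
  StarSubalgebra.le_topologicalClosure _ (StarAlgebra.subset_adjoin ℂ _ ⟨x, rfl⟩)

theorem annih_apply (x : ℤ) (f : Fock) (X : Finset ℤ) :
    annih x f X = (if x ∈ X then 0 else 1) * f (insert x X) := rfl

theorem number_apply (x : ℤ) (f : Fock) (X : Finset ℤ) :
    (star (annih x) * annih x) f X = if x ∈ X then f X else 0 := by
  have key : ∀ (g : Fock) (Z : Finset ℤ), inner ℂ (lp.single 2 Z (1 : ℂ) : Fock) g = g Z := by
    intro g Z
    rw [lp.inner_single_left]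
    simp
  have hsingle : annih x (lp.single 2 X (1 : ℂ)) =
      if x ∈ X then (lp.single 2 (X.erase x) (1 : ℂ) : Fock) else 0 := by
    refine lp.ext (funext fun Y => ?_)
    rw [annih_apply]
    by_cases hx : x ∈ X
    · simp only [hx, if_true, lp.single_apply, Pi.single_apply]
      by_cases hY : x ∈ Y
      · have : Y ≠ X.erase x := fun h => by simp [h] at hY
        simp [hY, this]
      · have : insert x Y = X ↔ Y = X.erase x := by
          constructor
          · rintro rfl
            rw [Finset.erase_insert hY]
          · rintro rfl
            exact Finset.insert_erase hx
        simp [hY, this]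
    · have : insert x Y ≠ X := fun h => hx (h ▸ Finset.mem_insert_self _ _)
      simp [hx, lp.single_apply, Pi.single_apply, this]
  have h1 : (star (annih x) * annih x) f X
      = inner ℂ (annih x (lp.single 2 X (1 : ℂ))) (annih x f) := by
    rw [← key, ContinuousLinearMap.star_eq_adjoint, mul_apply_eq_comp]
    exact ContinuousLinearMap.adjoint_inner_right _ _ _
  rw [h1, hsingle]
  by_cases hx : x ∈ X
  · rw [if_pos hx, if_pos hx, key, annih_apply]
    simp [Finset.insert_erase hx]
  · rw [if_neg hx, if_neg hx, inner_zero_left]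

theorem jwString_succ (x : ℤ) :
    jwString (x + 1) = jwString x * (1 - (2 : ℂ) • (star (annih x) * annih x)) := by
  ext f X
  change jwString (x + 1) f X = jwString x ((1 - (2 : ℂ) • (star (annih x) * annih x)) f) X
  rw [jwString, jwString, weighted_apply, weighted_apply]
  have h2 : ((1 - (2 : ℂ) • (star (annih x) * annih x)) f) (id X)
      = f X - 2 * (if x ∈ X then f X else 0) := by
    rw [← number_apply]
    rfl
  rw [h2]
  by_cases hx : x ∈ X
  · have : X.filter (· < x + 1) = insert x (X.filter (· < x)) := by
      ext j
      simp only [Finset.mem_filter, Finset.mem_insert]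
      constructor
      · rintro ⟨h, h'⟩
        rcases eq_or_ne j x with rfl | hne
        · exact Or.inl rfl
        · exact Or.inr ⟨h, by omega⟩
      · rintro (rfl | ⟨h, h'⟩)
        · exact ⟨hx, by omega⟩
        · exact ⟨h, by omega⟩
    rw [this, Finset.card_insert_of_notMem (by simp), pow_succ, if_pos hx]
    simp only [id]
    ring
  · have : X.filter (· < x + 1) = X.filter (· < x) := by
      ext j
      simp only [Finset.mem_filter]
      constructor
      · rintro ⟨h, h'⟩
        have : j ≠ x := fun e => hx (e ▸ h)
        exact ⟨h, by omega⟩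
      · rintro ⟨h, h'⟩
        exact ⟨h, by omega⟩
    rw [this, if_neg hx]
    simp

theorem jwString_comm (x y : ℤ) : jwString x * jwString y = jwString y * jwString x := by
  ext f X
  change jwString x (jwString y f) X = jwString y (jwString x f) X
  simp only [jwString, weighted_apply, id]
  ring

theorem jwString_sq (x : ℤ) : jwString x * jwString x = 1 := by
  ext f X
  change jwString x (jwString x f) X = f X
  simp only [jwString, weighted_apply, id]
  rw [← mul_assoc, ← mul_pow]
  simp

theorem star_jwString (x : ℤ) : star (jwString x) = jwString x := by
  rw [ContinuousLinearMap.star_eq_adjoint]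
  symm
  rw [ContinuousLinearMap.eq_adjoint_iff]
  intro f g
  rw [lp.inner_eq_tsum, lp.inner_eq_tsum]
  refine tsum_congr fun X => ?_
  simp only [jwString, weighted_apply, id, RCLike.inner_apply, map_mul, map_pow, map_neg, map_one]
  ring

theorem jwString_mul_mem (x y : ℤ) : jwString x * jwString y ∈ observables := by
  have key : ∀ (z : ℤ) (n : ℕ), jwString z * jwString (z + n) ∈ observables := by
    intro z n
    induction n with
    | zero =>
      simp only [Nat.cast_zero, add_zero, jwString_sq]
      exact one_mem _
    | succ n ih =>
      have h : z + ((n + 1 : ℕ) : ℤ) = z + n + 1 := by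
        push_cast
        ring
      rw [h, jwString_succ, ← mul_assoc]
      exact mul_mem ih (sub_mem (one_mem _)
        (SMulMemClass.smul_mem _ (mul_mem (star_mem (annih_mem _)) (annih_mem _))))
  rcases le_total x y with h | h
  · obtain ⟨n, rfl⟩ := Int.le.dest h
    exact key x n
  · obtain ⟨n, rfl⟩ := Int.le.dest h
    rw [jwString_comm]
    exact key y n

theorem fermi_pair_mem (x y : ℤ) : star (fermi x) * fermi y ∈ observables := by
  have h : star (fermi x) * fermi y
      = star (annih x) * (jwString x * jwString y) * annih y := by
    simp only [fermi, star_mul, star_jwString, mul_assoc]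
  rw [h]
  exact mul_mem (mul_mem (star_mem (annih_mem x)) (jwString_mul_mem x y)) (annih_mem y)

/-- The observable `c*(x) c(y)`. -/
def fermiPair (x y : ℤ) : Obs := ⟨star (fermi x) * fermi y, fermi_pair_mem x y⟩

/-- The annihilation operator `a(x)` as an observable. -/
def ann (x : ℤ) : Obs := ⟨annih x, annih_mem x⟩

/-- The operator `a(x)` of the box `[-N, N]`, with the empty boundary condition: it is `0` for
`x` outside the box. -/
def annBox (N : ℕ) (x : ℤ) : Obs := if x ∈ Finset.Icc (-(N : ℤ)) N then ann x else 0

/-- The Hamiltonian `-½ ∑_x a*(x) (Δ a)(x)` of hard-core bosons in the box `[-N, N]`, where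
`(Δ a)(x) = a(x + 1) + a(x - 1) - 2 a(x)`. -/
def hamiltonian (N : ℕ) : Obs :=
  (-(1 / 2) : ℂ) • ∑ x ∈ Finset.Icc (-(N : ℤ)) N,
    star (ann x) * (annBox N (x + 1) + annBox N (x - 1) - (2 : ℂ) • ann x)

/-- The Heisenberg evolution `A ↦ e^{i s H} A e^{-i s H}` of the box `[-N, N]`. -/
def boxEvolution (N : ℕ) (s : ℝ) (A : Obs) : Obs :=
  NormedSpace.exp ((Complex.I * s) • hamiltonian N) * A *
    NormedSpace.exp (-((Complex.I * s) • hamiltonian N))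

/-- The infinite-volume Heisenberg evolution `α_s`, the norm limit of the evolutions of the boxes
`[-N, N]` as `N → ∞`. -/
def evolution (s : ℝ) (A : Obs) : Obs := limUnder atTop fun N : ℕ => boxEvolution N s A

/-- A state on the algebra of observables: a positive linear functional `ω` with `ω(1) = 1`. -/
structure State where
  /-- The functional. -/
  toFun : Obs →L[ℂ] ℂ
  /-- Normalization. -/
  map_one : toFun 1 = 1
  /-- Positivity. -/
  nonneg : ∀ A : Obs, 0 ≤ (toFun (star A * A)).re ∧ (toFun (star A * A)).im = 0

/-- Real test functions of position `r` and wave number `k`. -/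
abbrev Test : Type := 𝓓((⊤ : TopologicalSpace.Opens (ℝ × ℝ)), ℝ)

/-- Complex distributions in position `r` and wave number `k`. -/
abbrev Dist : Type := 𝓓'((⊤ : TopologicalSpace.Opens (ℝ × ℝ)), ℂ)

/-- The expectation `(r, k) ↦ ν[n(ε⁻¹ r, k)]` of the locally conserved quantities
`n(R, k) = ∑_η e^{2 i η k} c*(R + η) c(R - η)`, with `η = m / 2` half-integer and the sites replaced
by their integral parts, as a distribution in `(r, k)` applied to the test function `φ`. -/
def wigner (ν : Obs → ℂ) (ε : ℝ) (φ : Test) : ℂ :=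
  ∑' m : ℤ, ∫ p : ℝ × ℝ, (φ p : ℂ) * Complex.exp (Complex.I * m * p.2) *
    ν (fermiPair ⌊p.1 / ε + m / 2⌋ ⌊p.1 / ε - m / 2⌋)

/-- The test function `sin k * ∂_r φ`. -/
def transport (φ : Test) : Test :=
  let ψ : Test := ∂_{((1 : ℝ), (0 : ℝ))} φ
  { toFun := fun p => Real.sin p.2 * ψ p
    contDiff' := ContDiff.mul (Real.contDiff_sin.comp contDiff_snd) ψ.contDiff
    hasCompactSupport' :=
      HasCompactSupport.mul_left (f := fun p : ℝ × ℝ => Real.sin p.2) ψ.hasCompactSupport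
    tsupport_subset' := fun _ _ => trivial }

/-- The distribution `T` is the locally integrable function `g`. -/
def Represents (g : ℝ × ℝ → ℂ) (T : Dist) : Prop :=
  LocallyIntegrable g ∧ ∀ φ : Test, T φ = ∫ p : ℝ × ℝ, (φ p : ℂ) * g p

end HardCore

end

noncomputable section

namespace HardCore

/-! ### The fermionic operators -/

/-! The dynamics is free in the fermionic operators. Strings at neighbouring sites cancel in the
hopping terms, so the Hamiltonian is quadratic in the `fermi x`, and the anticommutation relations
make its commutator with a pair `c*(x) c(y)` a combination of pairs (`hamiltonian_commutator`).
Two-point functions therefore solve a closed linear equation on `ℤ²` with bounded generator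
`hopping`. A box evolution and the global solution differ only through the boundary; reaching a
fixed site from there takes n hops, which costs `(2|s|)^n / n!`, and this gives the infinite-volume
limit (`tendsto_boxEvolution`).

In Wigner variables, moving one argument by a site moves the centre by `ε/2` and the Fourier index
by one. Integer shifts pass through the floor, so there is no rounding error: `hopping` acts on test
functions exactly as multiplication by `sin k` followed by a symmetric difference in `r` of total
step `ε` (`wignerTransform_hopping`). By Taylor expansion this is `ε sin k ∂_r` up to `O(ε²)`. Over
a microscopic time `t/ε` the error adds up to `O(ε)`, so the transform at time `t` agrees in the
limit with the initial transform tested on `φ(r + t sin k, k)`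
(`norm_wignerTransform_correlation_sub_le`).

All estimates are uniform in `ε` and in the state: pairs have norm at most one, and two integrations
by parts in `k` make the m-th Fourier mode `O(1 / (1 + m²))` (`norm_mode_le`). The same bound shows
that the limit is a distribution and that it may be differentiated along the flow. The remaining
claims follow since the shear preserves Lebesgue measure. -/

theorem fermi_apply (x : ℤ) (f : Fock) (X : Finset ℤ) :
    fermi x f X = (-1) ^ (X.filter (· < x)).card * ((if x ∈ X then 0 else 1) * f (insert x X)) :=
  rfl

theorem inner_single_one (g : Fock) (Z : Finset ℤ) :
    inner ℂ (lp.single 2 Z (1 : ℂ) : Fock) g = g Z := by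
  rw [lp.inner_single_left]
  simp

/-- This sign, present only when the new particle lies to the left of `y`, is the source of all the
anticommutation below. -/
theorem card_filter_insert {X : Finset ℤ} {x : ℤ} (hx : x ∉ X) (y : ℤ) :
    ((-1 : ℂ)) ^ ((insert x X).filter (· < y)).card
      = (if x < y then -1 else 1) * (-1) ^ (X.filter (· < y)).card := by
  rw [Finset.filter_insert]
  split_ifs with h
  · rw [Finset.card_insert_of_notMem (by simp [hx]), pow_succ]
    ring
  · rw [one_mul]

/-- The action on basis vectors is what determines the coordinates of the adjoint in
`star_fermi_apply`. -/
theorem fermi_single (x : ℤ) (X : Finset ℤ) :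
    fermi x (lp.single 2 X (1 : ℂ)) =
      if x ∈ X then (((-1 : ℂ) ^ (X.filter (· < x)).card) •
        lp.single 2 (X.erase x) (1 : ℂ) : Fock) else 0 := by
  refine lp.ext (funext fun Y => ?_)
  rw [fermi_apply]
  by_cases hx : x ∈ X
  · simp only [hx, if_true, lp.coeFn_smul, Pi.smul_apply, lp.single_apply, Pi.single_apply,
      smul_eq_mul]
    by_cases hY : x ∈ Y
    · have : Y ≠ X.erase x := fun h => by simp [h] at hY
      simp [hY, this]
    · by_cases h : Y = X.erase x
      · subst h
        have h' := card_filter_insert hY x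
        rw [Finset.insert_erase hx] at h'
        simp [Finset.insert_erase hx, h']
      · have : insert x Y ≠ X := by
          rintro rfl
          exact h (Finset.erase_insert hY).symm
        simp [this, h]
  · have : insert x Y ≠ X := fun h => hx (h ▸ Finset.mem_insert_self _ _)
    simp [hx, lp.single_apply, this]

theorem star_fermi_apply (x : ℤ) (f : Fock) (X : Finset ℤ) :
    star (fermi x) f X
      = (-1) ^ (X.filter (· < x)).card * ((if x ∈ X then 1 else 0) * f (X.erase x)) := by
  have h1 : star (fermi x) f X = inner ℂ (fermi x (lp.single 2 X (1 : ℂ))) f := by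
    rw [← inner_single_one, ContinuousLinearMap.star_eq_adjoint]
    exact ContinuousLinearMap.adjoint_inner_right _ _ _
  rw [h1, fermi_single]
  by_cases hx : x ∈ X
  · rw [if_pos hx, if_pos hx, inner_smul_left, inner_single_one]
    simp
  · rw [if_neg hx, if_neg hx, inner_zero_left]
    simp

theorem fermi_mul_fermi (x y : ℤ) : fermi x * fermi y = -(fermi y * fermi x) := by
  ext f X
  change fermi x (fermi y f) X = -(fermi y (fermi x f) X)
  simp only [fermi_apply]
  rcases eq_or_ne x y with rfl | hxy
  · simp
  by_cases hx : x ∈ X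
  · simp [hx]
  by_cases hy : y ∈ X
  · simp [hy]
  rw [card_filter_insert hx, card_filter_insert hy, Finset.insert_comm y x X]
  simp only [Finset.mem_insert, hx, hy, hxy, hxy.symm, or_false, if_false]
  -- Exactly one of the two sites lies to the left of the other, so exactly one of the two orders
  -- picks up an extra minus sign.
  rcases lt_or_gt_of_ne hxy with h | h
  · simp [h, h.not_gt]
    ring
  · simp [h, h.not_gt]
    ring

theorem fermi_mul_star_fermi (x y : ℤ) :
    fermi x * star (fermi y) + star (fermi y) * fermi x = if x = y then 1 else 0 := by
  ext f X
  have h : (fermi x * star (fermi y) + star (fermi y) * fermi x) f X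
    = fermi x (star (fermi y) f) X + star (fermi y) (fermi x f) X := rfl
  rw [h]
  simp only [fermi_apply, star_fermi_apply]
  rcases eq_or_ne x y with rfl | hxy
  · by_cases hx : x ∈ X
    · have h' := card_filter_insert (Finset.notMem_erase x X) x
      rw [Finset.insert_erase hx] at h'
      simp only [hx, if_true, Finset.notMem_erase, if_false, Finset.insert_erase hx, h']
      simp [← mul_assoc, ← mul_pow]
    · simp [hx, card_filter_insert hx, ← mul_assoc, ← mul_pow]
  rw [if_neg hxy]
  by_cases hx : x ∈ X
  · simp [hx, hxy]
  by_cases hy : y ∈ X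
  · have hx' : x ∉ X.erase y := fun h => hx (Finset.mem_of_mem_erase h)
    have h' := card_filter_insert (Finset.notMem_erase y X) x
    rw [Finset.insert_erase hy] at h'
    rw [card_filter_insert hx, Finset.erase_insert_of_ne hxy, h']
    simp only [Finset.mem_insert, hx, hx', hy, or_true, if_true, if_false]
    rcases lt_or_gt_of_ne hxy with h | h
    · simp [h, h.not_gt]
      ring
    · simp [h, h.not_gt]
      ring
  · simp [hx, hy, hxy.symm]

theorem star_fermi_mul_star_fermi (x y : ℤ) :
    star (fermi x) * star (fermi y) = -(star (fermi y) * star (fermi x)) := by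
  have h := congrArg star (fermi_mul_fermi y x)
  rwa [star_neg, star_mul, star_mul] at h

/-- Normal ordering both products leaves the same quartic term, which cancels; only the contractions
survive. This is why the equations for two-point functions close. -/
theorem fermi_pair_commutator (p q x y : ℤ) :
    star (fermi p) * fermi q * (star (fermi x) * fermi y)
        - star (fermi x) * fermi y * (star (fermi p) * fermi q)
      = (if q = x then star (fermi p) * fermi y else 0)
        - (if y = p then star (fermi x) * fermi q else 0) := by
  have h1 := eq_sub_of_add_eq (fermi_mul_star_fermi q x)
  have h2 := eq_sub_of_add_eq (fermi_mul_star_fermi y p)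
  have e1 : star (fermi p) * fermi q * (star (fermi x) * fermi y)
      = star (fermi p) * (fermi q * star (fermi x)) * fermi y := by noncomm_ring
  have e2 : star (fermi x) * fermi y * (star (fermi p) * fermi q)
      = star (fermi x) * (fermi y * star (fermi p)) * fermi q := by noncomm_ring
  -- The two quartic terms agree because exchanging the creators and exchanging the annihilators
  -- gives two signs.
  have e3 : star (fermi p) * (star (fermi x) * fermi q) * fermi y
      = star (fermi x) * (star (fermi p) * fermi y) * fermi q := by
    have : star (fermi p) * (star (fermi x) * fermi q) * fermi y
      = (star (fermi p) * star (fermi x)) * (fermi q * fermi y) := by noncomm_ring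
    rw [this, star_fermi_mul_star_fermi, fermi_mul_fermi]
    noncomm_ring
  rw [e1, e2, h1, h2, mul_sub, sub_mul, mul_sub, sub_mul, e3]
  split_ifs <;> (simp; try abel)

theorem norm_weighted_le (w : Finset ℤ → ℂ) (s : Finset ℤ → Finset ℤ)
    (hw : ∀ X, ‖w X‖ ≤ 1) (hs : Set.InjOn s {X | w X ≠ 0}) : ‖weighted w s hw hs‖ ≤ 1 :=
  LinearMap.mkContinuous_norm_le _ zero_le_one _

theorem norm_fermi_le (x : ℤ) : ‖fermi x‖ ≤ 1 :=
  (norm_mul_le _ _).trans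
    (mul_le_one₀ (norm_weighted_le _ _ _ _) (norm_nonneg _) (norm_weighted_le _ _ _ _))

theorem norm_fermiPair_le (x y : ℤ) : ‖fermiPair x y‖ ≤ 1 := by
  have h : ‖star (fermi x)‖ = ‖fermi x‖ :=
    (ContinuousLinearMap.adjoint (𝕜 := ℂ) (E := Fock) (F := Fock)).norm_map (fermi x)
  refine (norm_mul_le (star (fermi x)) (fermi y)).trans
    (mul_le_one₀ (h.trans_le (norm_fermi_le x)) (norm_nonneg _) (norm_fermi_le y))

/-! ### The Hamiltonian in terms of the fermionic operators -/

theorem annih_mul_annih_self (x : ℤ) : annih x * annih x = 0 := by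
  ext f X
  change annih x (annih x f) X = 0
  simp [annih_apply]

/-- The strings at `x` and `x + 1` differ by the factor `1 - 2 a*(x) a(x)`, which `a*(x)` absorbs
from the left since `a*(x)² = 0`. For more distant sites a string would remain. -/
theorem star_annih_mul_succ (x : ℤ) :
    star (annih x) * annih (x + 1) = star (fermi x) * fermi (x + 1) := by
  have h : star (annih x) * star (annih x) = 0 := by
    rw [← star_mul, annih_mul_annih_self, star_zero]
  have h' : star (fermi x) * fermi (x + 1)
      = star (annih x) * (jwString x * jwString x)
        * (1 - (2 : ℂ) • (star (annih x) * annih x)) * annih (x + 1) := by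
    simp only [fermi, star_mul, star_jwString, jwString_succ, mul_assoc]
  rw [h', jwString_sq, mul_one, mul_sub, mul_one, mul_smul_comm, ← mul_assoc, h, zero_mul,
    smul_zero, sub_zero]

theorem star_annih_mul_self (x : ℤ) :
    star (annih x) * annih x = star (fermi x) * fermi x := by
  have h' : star (fermi x) * fermi x
      = star (annih x) * (jwString x * jwString x) * annih x := by
    simp only [fermi, star_mul, star_jwString, mul_assoc]
  rw [h', jwString_sq, mul_one]

theorem star_ann_mul_succ (x : ℤ) : star (ann x) * ann (x + 1) = fermiPair x (x + 1) :=
  Subtype.ext (star_annih_mul_succ x)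

theorem star_fermiPair (x y : ℤ) : star (fermiPair x y) = fermiPair y x :=
  Subtype.ext <| by
    change star (star (fermi x) * fermi y) = star (fermi y) * fermi x
    rw [star_mul, star_star]

theorem star_ann_mul_pred (x : ℤ) : star (ann x) * ann (x - 1) = fermiPair x (x - 1) := by
  have h := congrArg star (star_ann_mul_succ (x - 1))
  rwa [sub_add_cancel, star_fermiPair, star_mul, star_star] at h

theorem star_ann_mul_self (x : ℤ) : star (ann x) * ann x = fermiPair x x :=
  Subtype.ext (star_annih_mul_self x)

/-- The matrix of the lattice Laplacian on `ℤ`. -/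
def laplacian (p q : ℤ) : ℂ :=
  (if q = p + 1 then 1 else 0) + (if q = p - 1 then 1 else 0) - (if q = p then 2 else 0)

theorem laplacian_symm (p q : ℤ) : laplacian p q = laplacian q p := by
  have h1 : q = p + 1 ↔ p = q - 1 := by omega
  have h2 : q = p - 1 ↔ p = q + 1 := by omega
  simp only [laplacian, h1, h2, eq_comm (a := q) (b := p)]
  ring

theorem star_laplacian (p q : ℤ) : star (laplacian p q) = laplacian p q := by
  simp only [laplacian]
  split_ifs <;> simp

theorem sum_laplacian_smul {E : Type*} [AddCommGroup E] [Module ℂ E] (S : Finset ℤ) (p : ℤ)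
    (F : ℤ → E) :
    ∑ q ∈ S, laplacian p q • F q
      = (if p + 1 ∈ S then F (p + 1) else 0) + (if p - 1 ∈ S then F (p - 1) else 0)
        - (if p ∈ S then (2 : ℂ) • F p else 0) := by
  simp only [laplacian, sub_smul, add_smul, ite_smul, one_smul, zero_smul,
    Finset.sum_sub_distrib, Finset.sum_add_distrib, Finset.sum_ite_eq']

theorem hamiltonian_eq (N : ℕ) :
    hamiltonian N = (-(1 / 2) : ℂ) • ∑ p ∈ Finset.Icc (-(N : ℤ)) N, ∑ q ∈ Finset.Icc (-(N : ℤ)) N,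
      laplacian p q • fermiPair p q := by
  rw [hamiltonian]
  congr 1
  refine Finset.sum_congr rfl fun p hp => ?_
  rw [sum_laplacian_smul, if_pos hp, mul_sub, mul_add, annBox, annBox, mul_ite, mul_ite,
    star_ann_mul_succ, star_ann_mul_pred, mul_smul_comm, star_ann_mul_self, mul_zero]

theorem star_hamiltonian (N : ℕ) : star (hamiltonian N) = hamiltonian N := by
  rw [hamiltonian_eq, star_smul, star_sum, Finset.sum_comm]
  have h : star (-(1 / 2) : ℂ) = -(1 / 2) := by simp
  rw [h]
  congr 1
  refine Finset.sum_congr rfl fun p _ => ?_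
  rw [star_sum]
  refine Finset.sum_congr rfl fun q _ => ?_
  rw [star_smul, star_laplacian, star_fermiPair, laplacian_symm]

theorem fermiPair_commutator (p q x y : ℤ) :
    fermiPair p q * fermiPair x y - fermiPair x y * fermiPair p q
      = (if q = x then fermiPair p y else 0) - (if y = p then fermiPair x q else 0) := by
  refine Subtype.ext ?_
  refine (fermi_pair_commutator p q x y).trans ?_
  split_ifs <;> rfl

/-- The generator `(ℒ F)(x, y) = -(i / 2) (F(x + 1, y) + F(x - 1, y) - F(x, y + 1) - F(x, y - 1))`
of the evolution of two-point functions. -/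
def hopping {E : Type*} [AddCommGroup E] [Module ℂ E] (F : ℤ → ℤ → E) (x y : ℤ) : E :=
  (-(Complex.I / 2)) • (F (x + 1) y + F (x - 1) y - F x (y + 1) - F x (y - 1))

/-- The strict inequalities keep all neighbours of `x` and `y` inside the box. The diagonal parts of
the two Laplacians cancel, which is why `hopping` has no diagonal term. -/
theorem hamiltonian_commutator {N : ℕ} {x y : ℤ} (hx : |x| < N) (hy : |y| < N) :
    Complex.I • (hamiltonian N * fermiPair x y - fermiPair x y * hamiltonian N)
      = hopping fermiPair x y := by
  rw [abs_lt] at hx hy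
  set S := Finset.Icc (-(N : ℤ)) N with hS
  have mem : ∀ z : ℤ, -(N : ℤ) ≤ z → z ≤ N → z ∈ S := fun z h h' => Finset.mem_Icc.2 ⟨h, h'⟩
  have hxS := mem x (by omega) (by omega)
  have hyS := mem y (by omega) (by omega)
  have e : hamiltonian N * fermiPair x y - fermiPair x y * hamiltonian N
      = (-(1 / 2) : ℂ) • ((∑ p ∈ S, laplacian x p • fermiPair p y)
        - ∑ q ∈ S, laplacian y q • fermiPair x q) := by
    rw [hamiltonian_eq, smul_mul_assoc, mul_smul_comm, ← smul_sub]
    congr 1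
    simp only [Finset.sum_mul, Finset.mul_sum, smul_mul_assoc, mul_smul_comm]
    simp only [← Finset.sum_sub_distrib, ← smul_sub, fermiPair_commutator]
    simp only [smul_sub, Finset.sum_sub_distrib, smul_ite, smul_zero]
    congr 1
    · refine Finset.sum_congr rfl fun p _ => ?_
      rw [Finset.sum_ite_eq', if_pos hxS, laplacian_symm]
    · rw [Finset.sum_comm]
      refine Finset.sum_congr rfl fun q _ => ?_
      rw [Finset.sum_ite_eq, if_pos hyS]
  rw [e, sum_laplacian_smul, sum_laplacian_smul, if_pos hxS, if_pos hyS,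
    if_pos (mem _ (by omega) (by omega)), if_pos (mem _ (by omega) (by omega)),
    if_pos (mem _ (by omega) (by omega)), if_pos (mem _ (by omega) (by omega)), hopping, smul_smul]
  congr 1
  · ring
  · abel

/-! ### Heisenberg evolution and states in a C*-algebra -/

section CStar

variable {A : Type*} [CStarAlgebra A]

/-- The Heisenberg evolution `a ↦ e^{i s H} a e^{-i s H}` in a C*-algebra. -/
def heisenberg (H : A) (s : ℝ) (a : A) : A :=
  NormedSpace.exp ((Complex.I * s) • H) * a * NormedSpace.exp (-((Complex.I * s) • H))

theorem exp_mem_unitary {H : A} (hH : star H = H) (z : ℝ) :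
    NormedSpace.exp ((Complex.I * z) • H) ∈ unitary A := by
  have : (Complex.I * z) • H ∈ skewAdjoint A := by
    rw [skewAdjoint.mem_iff, star_smul, hH]
    simp
  let _ : NormedAlgebra ℚ A := NormedAlgebra.restrictScalars ℚ ℂ A
  exact NormedSpace.exp_mem_unitary_of_mem_skewAdjoint this

theorem norm_heisenberg {H : A} (hH : star H = H) (s : ℝ) (a : A) : ‖heisenberg H s a‖ = ‖a‖ := by
  have h : -((Complex.I * s) • H) = (Complex.I * ((-s : ℝ) : ℂ)) • H := by
    rw [← neg_smul]
    push_cast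
    ring_nf
  rw [heisenberg, h, CStarRing.norm_mul_mem_unitary _ (exp_mem_unitary hH _),
    CStarRing.norm_mem_unitary_mul _ (exp_mem_unitary hH _)]

theorem heisenberg_zero (H a : A) : heisenberg H 0 a = a := by
  simp [heisenberg]

theorem heisenberg_add (H : A) (s : ℝ) (a b : A) :
    heisenberg H s (a + b) = heisenberg H s a + heisenberg H s b := by
  simp only [heisenberg, mul_add, add_mul]

theorem heisenberg_sub (H : A) (s : ℝ) (a b : A) :
    heisenberg H s (a - b) = heisenberg H s a - heisenberg H s b := by
  simp only [heisenberg, mul_sub, sub_mul]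

theorem heisenberg_smul (H : A) (s : ℝ) (c : ℂ) (a : A) :
    heisenberg H s (c • a) = c • heisenberg H s a := by
  simp only [heisenberg, mul_smul_comm, smul_mul_assoc]

theorem hasDerivAt_heisenberg (H : A) (s : ℝ) (a : A) :
    HasDerivAt (fun u : ℝ => heisenberg H u a)
      (heisenberg H s (Complex.I • (H * a - a * H))) s := by
  have e : ∀ u : ℝ, (Complex.I * u) • H = u • (Complex.I • H) := fun u => by
    rw [mul_comm, mul_smul, Complex.coe_smul]
  have e' : ∀ u : ℝ, -((Complex.I * u) • H) = u • (-(Complex.I • H)) := fun u => by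
    rw [e, smul_neg]
  have h1 := hasDerivAt_exp_smul_const (𝕂 := ℝ) (Complex.I • H) s
  have h2 := hasDerivAt_exp_smul_const' (𝕂 := ℝ) (-(Complex.I • H)) s
  have h3 := (h1.mul_const a).mul h2
  have h4 : (fun u : ℝ => heisenberg H u a) = (fun u : ℝ => NormedSpace.exp (u • Complex.I • H) * a)
      * fun u : ℝ => NormedSpace.exp (u • -(Complex.I • H)) := by
    funext u
    rw [heisenberg, e', e]
    rfl
  rw [h4, heisenberg, e', e]
  refine h3.congr_deriv ?_
  simp only [mul_assoc, smul_mul_assoc, mul_smul_comm, mul_sub, sub_mul, smul_sub, neg_mul, mul_neg]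
  abel

/-! ### Normalized positive functionals. -/

variable {φ : A →L[ℂ] ℂ}

theorem positive_star (hone : φ 1 = 1)
    (hpos : ∀ a, 0 ≤ (φ (star a * a)).re ∧ (φ (star a * a)).im = 0) (a : A) :
    φ (star a) = star (φ a) := by
  -- Polarization: positivity at `a + 1` fixes the imaginary part of `φ (star a)`, positivity at `a
  -- + i` its real part.
  have h1 := (hpos (a + 1)).2
  have h2 := (hpos (a + Complex.I • 1)).2
  have h0 := (hpos a).2
  simp only [star_add, star_one, add_mul, mul_add, one_mul, mul_one, map_add, hone,
    Complex.add_im, h0, Complex.one_im] at h1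
  simp only [star_add, star_smul, star_one, add_mul, mul_add, map_add, mul_smul_comm,
    smul_mul_assoc, one_mul, mul_one, map_smul, hone, Complex.add_im, h0, smul_eq_mul,
    Complex.star_def, Complex.conj_I, Complex.mul_im, Complex.neg_im, Complex.neg_re,
    Complex.I_re, Complex.I_im] at h2
  refine Complex.ext ?_ ?_
  · rw [Complex.star_def, Complex.conj_re]
    linarith
  · rw [Complex.star_def, Complex.conj_im]
    linarith

/-- Nonnegativity of the variance gives `‖φ a‖² ≤ φ (a* a)`, and `‖a‖² - a* a` has the form `b* b`,
so `φ (a* a) ≤ ‖a‖²`. Contractivity is what makes the later bounds uniform over states. -/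
theorem norm_positive_apply_le (hone : φ 1 = 1)
    (hpos : ∀ a, 0 ≤ (φ (star a * a)).re ∧ (φ (star a * a)).im = 0) (a : A) : ‖φ a‖ ≤ ‖a‖ := by
  have h1 : (φ (star a * a)).re ≤ ‖a‖ ^ 2 := by
    let _ : PartialOrder A := CStarAlgebra.spectralOrder A
    let _ : StarOrderedRing A := CStarAlgebra.spectralOrderedRing A
    have h := sub_nonneg.2 (CStarAlgebra.star_mul_le_algebraMap_norm_sq (a := a))
    obtain ⟨b, hb⟩ := CStarAlgebra.nonneg_iff_eq_star_mul_self.1 h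
    have h' := (hpos b).1
    rw [← hb, map_sub, Algebra.algebraMap_eq_smul_one, ← Complex.coe_smul, map_smul, hone,
      smul_eq_mul, mul_one, Complex.sub_re, Complex.ofReal_re] at h'
    linarith
  have h2 : ‖φ a‖ ^ 2 ≤ (φ (star a * a)).re := by
    have h := (hpos (a - φ a • 1)).1
    simp only [star_sub, star_smul, star_one, sub_mul, mul_sub, map_sub, mul_smul_comm,
      smul_mul_assoc, one_mul, mul_one, map_smul, hone, positive_star hone hpos, smul_eq_mul,
      Complex.star_def] at h
    rw [Complex.sq_norm, Complex.normSq_apply]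
    simp only [Complex.sub_re, Complex.mul_re, Complex.conj_re, Complex.conj_im] at h
    linarith
  exact le_of_sq_le_sq (h2.trans h1) (norm_nonneg _)

end CStar

/-! ### Existence of the infinite-volume evolution -/

theorem norm_le_of_norm_deriv_le_pow {V : Type*} [NormedAddCommGroup V] [NormedSpace ℝ V]
    {u u' : ℝ → V} {K S : ℝ} {n : ℕ} (h0 : u 0 = 0)
    (hu : ∀ s, |s| ≤ S → HasDerivAt u (u' s) s) (hb : ∀ s, |s| ≤ S → ‖u' s‖ ≤ K * |s| ^ n)
    {s : ℝ} (hs : |s| ≤ S) : ‖u s‖ ≤ K * |s| ^ (n + 1) / (n + 1) := by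
  have key : ∀ v v' : ℝ → V, v 0 = 0 → (∀ s, |s| ≤ S → HasDerivAt v (v' s) s) →
      (∀ s, |s| ≤ S → ‖v' s‖ ≤ K * |s| ^ n) → ∀ s, 0 ≤ s → s ≤ S →
      ‖v s‖ ≤ K * s ^ (n + 1) / (n + 1) := by
    intro v v' h0 hv hb s hs0 hsS
    have habs : ∀ x ∈ Set.Icc 0 s, |x| ≤ S := fun x hx => by
      rw [abs_of_nonneg hx.1]
      exact hx.2.trans hsS
    have hB : ∀ x : ℝ, HasDerivAt (fun x : ℝ => K * x ^ (n + 1) / (n + 1)) (K * x ^ n) x := by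
      intro x
      have hn : (n : ℝ) + 1 ≠ 0 := by positivity
      refine (((hasDerivAt_pow (n + 1) x).const_mul K).div_const ((n : ℝ) + 1)).congr_deriv ?_
      simp only [Nat.add_sub_cancel, Nat.cast_add, Nat.cast_one]
      field_simp
    refine image_norm_le_of_norm_deriv_right_le_deriv_boundary (f' := v') (a := 0) (b := s)
      (fun x hx => (hv x (habs x hx)).continuousAt.continuousWithinAt)
      (fun x hx => (hv x (habs x (Set.Ico_subset_Icc_self hx))).hasDerivWithinAt)
      (by simp [h0]) hB (fun x hx => ?_) (Set.right_mem_Icc.2 hs0)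
    have h := hb x (habs x (Set.Ico_subset_Icc_self hx))
    rwa [abs_of_nonneg hx.1] at h
  rcases le_total 0 s with h | h
  · rw [abs_of_nonneg h] at hs ⊢
    exact key u u' h0 hu hb s h hs
  · rw [abs_of_nonpos h] at hs ⊢
    -- Negative times are reduced to positive ones by reflection.
    have h' := key (fun x => u (-x)) (fun x => -u' (-x)) (by simpa using h0)
      (fun x hx => by
        have h1 := (hu (-x) (by rwa [abs_neg])).scomp x (hasDerivAt_neg x)
        simpa [Function.comp_def] using h1)
      (fun x hx => by
        have h1 := hb (-x) (by rwa [abs_neg])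
        rwa [abs_neg, ← norm_neg] at h1) (-s) (by linarith) hs
    simpa using h'

theorem norm_hopping_le {V : Type*} [NormedAddCommGroup V] [NormedSpace ℂ V] {F : ℤ → ℤ → V}
    {x y : ℤ} {C : ℝ} (h1 : ‖F (x + 1) y‖ ≤ C) (h2 : ‖F (x - 1) y‖ ≤ C) (h3 : ‖F x (y + 1)‖ ≤ C)
    (h4 : ‖F x (y - 1)‖ ≤ C) : ‖hopping F x y‖ ≤ 2 * C := by
  rw [hopping, norm_smul]
  have h : ‖-(Complex.I / 2)‖ = 1 / 2 := by simp
  rw [h]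
  have h5 := norm_sub_le (F (x + 1) y + F (x - 1) y - F x (y + 1)) (F x (y - 1))
  have h6 := norm_sub_le (F (x + 1) y + F (x - 1) y) (F x (y + 1))
  have h7 := norm_add_le (F (x + 1) y) (F (x - 1) y)
  linarith

theorem hopping_sub {V : Type*} [AddCommGroup V] [Module ℂ V] (F G : ℤ → ℤ → V) (x y : ℤ) :
    hopping (fun x y => F x y - G x y) x y = hopping F x y - hopping G x y := by
  simp only [hopping, ← smul_sub]
  congr 1
  abel

/-- Finite speed of propagation for the hopping equation: a solution in the box `(-N, N)²` that
vanishes at time zero is small far away from the boundary. -/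
theorem norm_le_of_hopping {V : Type*} [NormedAddCommGroup V] [NormedSpace ℂ V]
    {D : ℝ → ℤ → ℤ → V} {C S : ℝ} {N : ℕ} (h0 : ∀ x y, D 0 x y = 0)
    (hC : ∀ s, |s| ≤ S → ∀ x y, ‖D s x y‖ ≤ C)
    (hD : ∀ s (x y : ℤ), |x| < N → |y| < N → HasDerivAt (fun u => D u x y) (hopping (D s) x y) s)
    (n : ℕ) : ∀ s (x y : ℤ), |s| ≤ S → |x| + n ≤ N → |y| + n ≤ N →
      ‖D s x y‖ ≤ C * 2 ^ n / n.factorial * |s| ^ n := by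
  induction n with
  | zero =>
    intro s x y hs _ _
    simpa using hC s hs x y
  | succ n ih =>
    intro s x y hs hx hy
    push_cast at hx hy
    -- One Duhamel step: the derivative involves only neighbouring sites, so each time integration
    -- gains `2|s|/(n + 1)` and uses up one site of distance to the boundary.
    have h := norm_le_of_norm_deriv_le_pow (u := fun u => D u x y)
      (u' := fun s => hopping (D s) x y) (K := 2 * (C * 2 ^ n / n.factorial)) (n := n) (h0 x y)
      (fun s _ => hD s x y (by omega) (by omega))
      (fun s hs => by
        have a1 : |x + 1| ≤ |x| + 1 := abs_add_le x 1
        have a2 : |x - 1| ≤ |x| + 1 := abs_sub x 1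
        have a3 : |y + 1| ≤ |y| + 1 := abs_add_le y 1
        have a4 : |y - 1| ≤ |y| + 1 := abs_sub y 1
        rw [mul_assoc]
        exact norm_hopping_le (ih s _ _ hs (by omega) (by omega)) (ih s _ _ hs (by omega) (by omega))
          (ih s _ _ hs (by omega) (by omega)) (ih s _ _ hs (by omega) (by omega))) hs
    refine h.trans_eq ?_
    rw [Nat.factorial_succ, pow_succ 2]
    push_cast
    field_simp

/-! ### The hopping equation on all of `ℤ²`. -/

section Orbit

variable {V : Type*} [NormedAddCommGroup V] [NormedSpace ℂ V]

theorem hopping_le (F : BoundedContinuousFunction (ℤ × ℤ) V) (p : ℤ × ℤ) :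
    ‖hopping (fun x y => F (x, y)) p.1 p.2‖ ≤ 2 * ‖F‖ :=
  norm_hopping_le (F.norm_coe_le_norm _) (F.norm_coe_le_norm _) (F.norm_coe_le_norm _)
    (F.norm_coe_le_norm _)

/-- The hopping generator as a bounded operator on the space of bounded functions on `ℤ²`. -/
def hoppingCLM (V : Type*) [NormedAddCommGroup V] [NormedSpace ℂ V] :
    BoundedContinuousFunction (ℤ × ℤ) V →L[ℂ] BoundedContinuousFunction (ℤ × ℤ) V :=
  LinearMap.mkContinuous
    { toFun := fun F => BoundedContinuousFunction.ofNormedAddCommGroupDiscrete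
        (fun p => hopping (fun x y => F (x, y)) p.1 p.2) (2 * ‖F‖) (hopping_le F)
      map_add' := fun F G => by
        ext p
        simp only [hopping, BoundedContinuousFunction.coe_ofNormedAddCommGroupDiscrete,
          BoundedContinuousFunction.coe_add, Pi.add_apply, ← smul_add]
        congr 1
        abel
      map_smul' := fun c F => by
        ext p
        simp only [hopping, BoundedContinuousFunction.coe_ofNormedAddCommGroupDiscrete,
          BoundedContinuousFunction.coe_smul, RingHom.id_apply, smul_comm c, smul_add, smul_sub] }
    2 fun F => (BoundedContinuousFunction.norm_le (by positivity)).2 fun p => by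
      simpa only [LinearMap.coe_mk, AddHom.coe_mk,
        BoundedContinuousFunction.coe_ofNormedAddCommGroupDiscrete] using hopping_le F p

theorem hoppingCLM_apply (F : BoundedContinuousFunction (ℤ × ℤ) V) (x y : ℤ) :
    hoppingCLM V F (x, y) = hopping (fun x y => F (x, y)) x y := by
  simp only [hoppingCLM, LinearMap.mkContinuous_apply, LinearMap.coe_mk, AddHom.coe_mk,
    BoundedContinuousFunction.coe_ofNormedAddCommGroupDiscrete]

/-- The solution of the hopping equation with initial value `F`. -/
def hoppingOrbit (F : BoundedContinuousFunction (ℤ × ℤ) V) (s : ℝ) :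
    BoundedContinuousFunction (ℤ × ℤ) V :=
  NormedSpace.exp (s • hoppingCLM V) F

theorem hoppingOrbit_zero (F : BoundedContinuousFunction (ℤ × ℤ) V) : hoppingOrbit F 0 = F := by
  simp [hoppingOrbit]

variable [CompleteSpace V]

theorem hasDerivAt_hoppingOrbit (F : BoundedContinuousFunction (ℤ × ℤ) V) (s : ℝ) :
    HasDerivAt (hoppingOrbit F) (hoppingCLM V (hoppingOrbit F s)) s := by
  have h := hasDerivAt_exp_smul_const' (𝕂 := ℝ) (hoppingCLM V) s
  exact ((ContinuousLinearMap.apply ℂ (BoundedContinuousFunction (ℤ × ℤ) V)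
    F).restrictScalars ℝ).hasFDerivAt.comp_hasDerivAt s h

theorem hasDerivAt_hoppingOrbit_apply (F : BoundedContinuousFunction (ℤ × ℤ) V) (s : ℝ) (x y : ℤ) :
    HasDerivAt (fun s => hoppingOrbit F s (x, y))
      (hopping (fun x y => hoppingOrbit F s (x, y)) x y) s := by
  have h := (BoundedContinuousFunction.evalCLM ℝ (x, y)).hasFDerivAt.comp_hasDerivAt s
    (hasDerivAt_hoppingOrbit F s)
  rw [← hoppingCLM_apply]
  exact h

end Orbit

/-- Closedness makes `Obs` a C*-algebra in its own right, so the results on abstract C*-algebras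
apply to it. -/
instance : IsClosed (observables : Set (Fock →L[ℂ] Fock)) :=
  StarSubalgebra.isClosed_topologicalClosure _

theorem norm_boxEvolution (N : ℕ) (s : ℝ) (A : Obs) : ‖boxEvolution N s A‖ = ‖A‖ :=
  norm_heisenberg (star_hamiltonian N) s A

theorem boxEvolution_zero (N : ℕ) (A : Obs) : boxEvolution N 0 A = A :=
  heisenberg_zero _ _

theorem boxEvolution_hopping (N : ℕ) (s : ℝ) (F : ℤ → ℤ → Obs) (x y : ℤ) :
    boxEvolution N s (hopping F x y) = hopping (fun x y => boxEvolution N s (F x y)) x y := by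
  simp only [hopping]
  refine (heisenberg_smul _ _ _ _).trans (congrArg _ ?_)
  refine (heisenberg_sub _ _ _ _).trans (congrArg₂ _ ?_ rfl)
  refine (heisenberg_sub _ _ _ _).trans (congrArg₂ _ ?_ rfl)
  exact heisenberg_add _ _ _ _

theorem hasDerivAt_boxEvolution {N : ℕ} {x y : ℤ} (hx : |x| < N) (hy : |y| < N) (s : ℝ) :
    HasDerivAt (fun u => boxEvolution N u (fermiPair x y))
      (hopping (fun x y => boxEvolution N s (fermiPair x y)) x y) s := by
  have h := hasDerivAt_heisenberg (hamiltonian N) s (fermiPair x y)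
  rw [← boxEvolution_hopping, ← hamiltonian_commutator hx hy]
  exact h

/-- The two-point functions `c*(x) c(y)` as a bounded function of `(x, y)`. -/
def fermiPairs : BoundedContinuousFunction (ℤ × ℤ) Obs :=
  BoundedContinuousFunction.ofNormedAddCommGroupDiscrete (fun p => fermiPair p.1 p.2) 1
    (fun _ => norm_fermiPair_le _ _)

theorem tendsto_boxEvolution (s : ℝ) (x y : ℤ) :
    Tendsto (fun N : ℕ => boxEvolution N s (fermiPair x y)) atTop
      (𝓝 (hoppingOrbit fermiPairs s (x, y))) := by
  obtain ⟨C, hC⟩ : ∃ C, ∀ u ∈ Set.Icc (-|s|) |s|, ‖hoppingOrbit fermiPairs u‖ ≤ C :=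
    isCompact_Icc.exists_bound_of_continuousOn
      fun u _ => (hasDerivAt_hoppingOrbit fermiPairs u).continuousAt.continuousWithinAt
  rw [tendsto_iff_norm_sub_tendsto_zero]
  obtain ⟨M, hM⟩ : ∃ M : ℕ, |x| ≤ M ∧ |y| ≤ M :=
    ⟨(max |x| |y|).toNat, by omega, by omega⟩
  -- In the box of size `n + M`, sites of modulus at most `M` are at least `n` hops away from the
  -- boundary.
  rw [← tendsto_add_atTop_iff_nat M]
  have hlim : Tendsto (fun n : ℕ => (1 + C) * ((2 * |s|) ^ n / n.factorial)) atTop (𝓝 0) := by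
    simpa using (FloorSemiring.tendsto_pow_div_factorial_atTop (2 * |s|)).const_mul (1 + C)
  refine squeeze_zero (fun _ => norm_nonneg _) (fun n => ?_) hlim
  have h := norm_le_of_hopping (N := n + M) (S := |s|) (C := 1 + C)
    (D := fun s x y => boxEvolution (n + M) s (fermiPair x y) - hoppingOrbit fermiPairs s (x, y))
    (fun x y => by
      simp only [boxEvolution_zero, hoppingOrbit_zero]
      exact sub_self (fermiPair x y))
    (fun u hu x y => (norm_sub_le _ _).trans (add_le_add
      ((norm_boxEvolution _ _ _).trans_le (norm_fermiPair_le x y))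
      ((BoundedContinuousFunction.norm_coe_le_norm _ _).trans (hC u (abs_le.1 hu)))))
    (fun u x y hx hy => by
      rw [hopping_sub]
      exact (hasDerivAt_boxEvolution hx hy u).sub (hasDerivAt_hoppingOrbit_apply _ u x y))
    n s x y le_rfl (by push_cast; omega) (by push_cast; omega)
  refine h.trans_eq ?_
  rw [mul_pow]
  ring

/-- `evolution` is a `limUnder`, meaningful only where the limit exists; pairs are the only
observables on which it is needed. -/
theorem evolution_fermiPair (s : ℝ) (x y : ℤ) :
    evolution s (fermiPair x y) = hoppingOrbit fermiPairs s (x, y) :=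
  (tendsto_boxEvolution s x y).limUnder_eq

theorem tendsto_evolution (s : ℝ) (x y : ℤ) :
    Tendsto (fun N : ℕ => boxEvolution N s (fermiPair x y)) atTop
      (𝓝 (evolution s (fermiPair x y))) := by
  rw [evolution_fermiPair]
  exact tendsto_boxEvolution s x y

theorem evolution_zero (x y : ℤ) : evolution 0 (fermiPair x y) = fermiPair x y := by
  rw [evolution_fermiPair, hoppingOrbit_zero]
  rfl

theorem norm_evolution_le (s : ℝ) (x y : ℤ) : ‖evolution s (fermiPair x y)‖ ≤ 1 :=
  le_of_tendsto (tendsto_evolution s x y).norm (Eventually.of_forall fun N =>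
    (norm_boxEvolution N s _).trans_le (norm_fermiPair_le x y))

/-! ### Two-point functions of a state. -/

theorem norm_state_le (ν : State) (A : Obs) : ‖ν.toFun A‖ ≤ ‖A‖ :=
  norm_positive_apply_le ν.map_one ν.nonneg A

/-- The two-point function `ν(α_s(c*(x) c(y)))` of a state `ν` at time `s`. -/
def correlation (ν : State) (s : ℝ) (x y : ℤ) : ℂ := ν.toFun (evolution s (fermiPair x y))

theorem norm_correlation_le (ν : State) (s : ℝ) (x y : ℤ) : ‖correlation ν s x y‖ ≤ 1 :=
  (norm_state_le ν _).trans (norm_evolution_le s x y)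

theorem hasDerivAt_correlation (ν : State) (s : ℝ) (x y : ℤ) :
    HasDerivAt (fun s => correlation ν s x y) (hopping (correlation ν s) x y) s := by
  have h := (ν.toFun.restrictScalars ℝ).hasFDerivAt.comp_hasDerivAt s
    (hasDerivAt_hoppingOrbit_apply fermiPairs s x y)
  have e : ∀ u x y, correlation ν u x y = ν.toFun (hoppingOrbit fermiPairs u (x, y)) :=
    fun u x y => by rw [correlation, evolution_fermiPair]
  have e' : hopping (correlation ν s) x y
      = ν.toFun (hopping (fun x y => hoppingOrbit fermiPairs s (x, y)) x y) := by
    simp only [hopping, map_smul, map_sub, map_add, e]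
  rw [e']
  simp only [e]
  exact h

/-! ### Operations on test functions -/

namespace Test

theorem differentiable (φ : Test) : Differentiable ℝ φ := φ.contDiff.differentiable (by simp)

theorem hasFDerivAt (φ : Test) (p : ℝ × ℝ) : HasFDerivAt φ (fderiv ℝ φ p) p :=
  (φ.differentiable p).hasFDerivAt

theorem contDiff_fderiv (φ : Test) : ContDiff ℝ 1 (fderiv ℝ φ) :=
  (contDiff_infty.1 φ.contDiff 2).fderiv_right (m := 1) (by norm_num)

theorem hasFDerivAt_fderiv (φ : Test) (p : ℝ × ℝ) :
    HasFDerivAt (fderiv ℝ φ) (fderiv ℝ (fderiv ℝ φ) p) p :=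
  (φ.contDiff_fderiv.differentiable (by simp) p).hasFDerivAt

theorem hasLineDerivAt (φ : Test) (p v : ℝ × ℝ) : HasLineDerivAt ℝ φ ((∂_{v} φ) p) p v := by
  have h : (∂_{v} φ) p = lineDeriv ℝ φ p v := by
    rw [TestFunction.lineDerivOp_eq_lineDerivCLM (𝕜 := ℝ), TestFunction.lineDerivCLM_apply_of_le]
    simp
  rw [h]
  exact (φ.differentiable p).lineDifferentiableAt.hasLineDerivAt

theorem lineDeriv_apply (φ : Test) (p v : ℝ × ℝ) : (∂_{v} φ) p = fderiv ℝ φ p v :=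
  (φ.hasLineDerivAt p v).unique ((φ.hasFDerivAt p).hasLineDerivAt v)

theorem integrable (φ : Test) : Integrable φ :=
  φ.continuous.integrable_of_hasCompactSupport φ.hasCompactSupport

/-- The product with `sin k`. -/
def mulSin (φ : Test) : Test where
  toFun := fun p => Real.sin p.2 * φ p
  contDiff' := (Real.contDiff_sin.comp contDiff_snd).mul φ.contDiff
  hasCompactSupport' :=
    HasCompactSupport.mul_left (f := fun p : ℝ × ℝ => Real.sin p.2) φ.hasCompactSupport
  tsupport_subset' := fun _ _ => trivial

theorem mulSin_apply (φ : Test) (p : ℝ × ℝ) : mulSin φ p = Real.sin p.2 * φ p := rfl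

theorem transport_apply (φ : Test) (p : ℝ × ℝ) :
    transport φ p = Real.sin p.2 * fderiv ℝ φ p (1, 0) := by
  rw [← lineDeriv_apply]
  rfl

theorem lineDeriv_mulSin (φ : Test) : ∂_{((1 : ℝ), (0 : ℝ))} (mulSin φ) = transport φ := by
  ext p
  have h1 := φ.hasLineDerivAt p (1, 0)
  have h2 : HasLineDerivAt ℝ (mulSin φ) (transport φ p) p (1, 0) := by
    have h3 := HasDerivAt.const_mul (Real.sin p.2) h1
    refine h3.congr_of_eventuallyEq (Eventually.of_forall fun t => ?_)
    simp [mulSin_apply]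
  exact ((mulSin φ).hasLineDerivAt p (1, 0)).unique h2

end Test

/-! ### Shears of phase space: `c` serves for the lattice shifts, `s` for the flow. -/

/-- The shear `(r, k) ↦ (r + c + s sin k, k)` of phase space. -/
def shear (c s : ℝ) : (ℝ × ℝ) ≃ₜ (ℝ × ℝ) where
  toFun p := (p.1 + c + s * Real.sin p.2, p.2)
  invFun p := (p.1 - c - s * Real.sin p.2, p.2)
  left_inv p := by
    refine Prod.ext ?_ rfl
    simp only
    ring
  right_inv p := by
    refine Prod.ext ?_ rfl
    simp only
    ring
  continuous_toFun := by fun_prop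
  continuous_invFun := by fun_prop

theorem shear_apply (c s : ℝ) (p : ℝ × ℝ) : shear c s p = (p.1 + c + s * Real.sin p.2, p.2) := rfl

theorem shear_symm_apply (c s : ℝ) (p : ℝ × ℝ) :
    (shear c s).symm p = (p.1 - c - s * Real.sin p.2, p.2) := rfl

/-- For fixed `k` the map is a translation in `r`; the swaps put `k` into the base of the skew
product. -/
theorem measurePreserving_shear (c s : ℝ) : MeasurePreserving (shear c s) := by
  have h : MeasurePreserving (fun p : ℝ × ℝ => (id p.1, p.2 + (c + s * Real.sin p.1)))
      ((volume : Measure ℝ).prod volume) (volume.prod volume) :=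
    (MeasurePreserving.id volume).skew_product (g := fun k r => r + (c + s * Real.sin k))
      (by fun_prop) (Eventually.of_forall fun k => map_add_right_eq_self _ _)
  have h' := (Measure.measurePreserving_swap.comp h).comp Measure.measurePreserving_swap
  have e : (shear c s : ℝ × ℝ → ℝ × ℝ)
      = (Prod.swap ∘ fun p : ℝ × ℝ => (id p.1, p.2 + (c + s * Real.sin p.1))) ∘ Prod.swap := by
    funext p
    simp [shear_apply, add_assoc]
  rw [e]
  exact h'

theorem contDiff_shear (c s : ℝ) : ContDiff ℝ ((⊤ : ℕ∞) : WithTop ℕ∞) (shear c s) := by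
  have h : ContDiff ℝ ((⊤ : ℕ∞) : WithTop ℕ∞)
      fun p : ℝ × ℝ => (p.1 + c + s * Real.sin p.2, p.2) := by fun_prop
  exact h

/-- The test function `φ(r + c + s sin k, k)`. -/
def pull (c s : ℝ) (φ : Test) : Test where
  toFun := φ ∘ shear c s
  contDiff' := φ.contDiff.comp (contDiff_shear c s)
  hasCompactSupport' := φ.hasCompactSupport.comp_homeomorph _
  tsupport_subset' := fun _ _ => trivial

theorem pull_apply (c s : ℝ) (φ : Test) (p : ℝ × ℝ) : pull c s φ p = φ (shear c s p) := rfl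

theorem pull_zero (φ : Test) : pull 0 0 φ = φ := by
  ext p
  simp [pull_apply, shear_apply]

theorem pull_pull (c s c' s' : ℝ) (φ : Test) :
    pull c s (pull c' s' φ) = pull (c + c') (s + s') φ := by
  ext p
  simp only [pull_apply, shear_apply]
  congr 2
  ring

theorem pull_mulSin (c s : ℝ) (φ : Test) : pull c s φ.mulSin = (pull c s φ).mulSin := rfl

theorem pull_add (c s : ℝ) (φ ψ : Test) : pull c s (φ + ψ) = pull c s φ + pull c s ψ := rfl

theorem pull_smul (c s a : ℝ) (φ : Test) : pull c s (a • φ) = a • pull c s φ := rfl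

theorem hasDerivAt_pull {c s : ℝ → ℝ} {a b τ : ℝ} (hc : HasDerivAt c a τ) (hs : HasDerivAt s b τ)
    (φ : Test) (p : ℝ × ℝ) :
    HasDerivAt (fun τ => pull (c τ) (s τ) φ p)
      (pull (c τ) (s τ) (a • ∂_{((1 : ℝ), (0 : ℝ))} φ + b • transport φ) p) τ := by
  have h1 : HasDerivAt (fun τ => (p.1 + c τ + s τ * Real.sin p.2, p.2))
      (a + b * Real.sin p.2, (0 : ℝ)) τ :=
    ((hc.const_add p.1).add (hs.mul_const _)).prodMk (hasDerivAt_const τ p.2)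
  have h2 := (φ.hasFDerivAt (shear (c τ) (s τ) p)).comp_hasDerivAt τ h1
  refine h2.congr_deriv ?_
  have e : (a + b * Real.sin p.2, (0 : ℝ)) = (a + b * Real.sin p.2) • ((1 : ℝ), (0 : ℝ)) := by simp
  have e2 : pull (c τ) (s τ) (a • ∂_{((1 : ℝ), (0 : ℝ))} φ + b • transport φ) p
    = a * (∂_{((1 : ℝ), (0 : ℝ))} φ) (shear (c τ) (s τ) p)
      + b * transport φ (shear (c τ) (s τ) p) := rfl
  rw [e2, e, map_smul, Test.lineDeriv_apply, Test.transport_apply, smul_eq_mul, shear_apply]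
  ring

/-- The sum of the `L¹` norms of the derivatives of order at most two. -/
def sobolev (φ : Test) : ℝ :=
  ∫ p, (‖φ p‖ + ‖fderiv ℝ φ p‖ + ‖iteratedFDeriv ℝ 2 φ p‖)

theorem integrable_sobolev (φ : Test) :
    Integrable fun p => ‖φ p‖ + ‖fderiv ℝ φ p‖ + ‖iteratedFDeriv ℝ 2 φ p‖ := by
  have i0 : Integrable fun p => ‖φ p‖ := φ.integrable.norm
  have i1 : Integrable fun p => ‖fderiv ℝ φ p‖ :=
    φ.contDiff_fderiv.continuous.norm.integrable_of_hasCompactSupport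
      (φ.hasCompactSupport.fderiv ℝ).norm
  have i2 : Integrable fun p => ‖iteratedFDeriv ℝ 2 φ p‖ :=
    ((contDiff_infty.1 φ.contDiff 2).continuous_iteratedFDeriv
      le_rfl).norm.integrable_of_hasCompactSupport (φ.hasCompactSupport.iteratedFDeriv 2).norm
  exact (i0.add i1).add i2

/-- The derivative in the wave number `k`. -/
def derivK (φ : Test) : Test := ∂_{((0 : ℝ), (1 : ℝ))} φ

theorem derivK_eq {φ : Test} {p : ℝ × ℝ} {a : ℝ}
    (h : HasDerivAt (fun t => φ (p.1, p.2 + t)) a 0) : derivK φ p = a := by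
  have h' : HasLineDerivAt ℝ φ a p (0, 1) := by
    refine h.congr_of_eventuallyEq (Eventually.of_forall fun t => ?_)
    refine congrArg φ (Prod.ext ?_ ?_) <;> simp
  exact (φ.hasLineDerivAt p (0, 1)).unique h'

/-- By the chain rule, each k-derivative of the sheared function is a derivative of `φ` along `(s
cos k, 1)`, and the second one also differentiates this direction. The bound does not depend on `c`
and is locally uniform in `s`. -/
theorem norm_derivK_derivK_pull_le (c s : ℝ) (φ : Test) (p : ℝ × ℝ) :
    ‖pull c s φ p‖ + ‖derivK (derivK (pull c s φ)) p‖
      ≤ (1 + |s|) ^ 2 * (‖φ (shear c s p)‖ + ‖fderiv ℝ φ (shear c s p)‖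
        + ‖iteratedFDeriv ℝ 2 φ (shear c s p)‖) := by
  have hshear : ∀ p : ℝ × ℝ, HasDerivAt (fun t => shear c s (p.1, p.2 + t))
      (s * Real.cos p.2, (1 : ℝ)) 0 := by
    intro p
    have h1 : HasDerivAt (fun t : ℝ => p.2 + t) 1 0 := (hasDerivAt_id 0).const_add _
    have h2 : HasDerivAt (fun t : ℝ => Real.sin (p.2 + t)) (Real.cos p.2) 0 := by
      simpa using h1.sin
    exact ((h2.const_mul s).const_add (p.1 + c)).prodMk h1
  have hp : ∀ p : ℝ × ℝ, shear c s (p.1, p.2 + 0) = shear c s p := fun p => by simp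
  have hK : ∀ p, derivK (pull c s φ) p = fderiv ℝ φ (shear c s p) (s * Real.cos p.2, 1) := by
    intro p
    refine derivK_eq ?_
    have h := φ.hasFDerivAt (shear c s (p.1, p.2 + 0))
    rw [← hp p]
    exact HasFDerivAt.comp_hasDerivAt (l := φ) (f := fun t => shear c s (p.1, p.2 + t)) (0 : ℝ) h
      (hshear p)
  have hKK : derivK (derivK (pull c s φ)) p
      = fderiv ℝ (fderiv ℝ φ) (shear c s p) (s * Real.cos p.2, 1) (s * Real.cos p.2, 1)
        + fderiv ℝ φ (shear c s p) (-(s * Real.sin p.2), 0) := by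
    refine derivK_eq ?_
    simp only [hK]
    have h1 : HasDerivAt (fun t : ℝ => p.2 + t) 1 0 := (hasDerivAt_id 0).const_add _
    have h2 : HasDerivAt (fun t : ℝ => (s * Real.cos (p.2 + t), (1 : ℝ)))
        (-(s * Real.sin p.2), 0) 0 := by
      have h3 := (h1.cos.const_mul s).prodMk (hasDerivAt_const (0 : ℝ) (1 : ℝ))
      simpa using h3
    have h4 := HasFDerivAt.comp_hasDerivAt (f := fun t => shear c s (p.1, p.2 + t)) (0 : ℝ)
      (φ.hasFDerivAt_fderiv (shear c s (p.1, p.2 + 0))) (hshear p)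
    have h5 := h4.clm_apply h2
    simp only [Function.comp_apply, add_zero] at h5
    exact h5
  have n1 : ‖(s * Real.cos p.2, (1 : ℝ))‖ ≤ 1 + |s| := by
    rw [Prod.norm_def]
    refine max_le ?_ ?_
    · simp only [Real.norm_eq_abs, abs_mul]
      nlinarith [Real.abs_cos_le_one p.2, abs_nonneg s]
    · simp
  have n2 : ‖(-(s * Real.sin p.2), (0 : ℝ))‖ ≤ |s| := by
    rw [Prod.norm_def]
    refine max_le ?_ ?_
    · simp only [Real.norm_eq_abs, abs_mul, abs_neg]
      nlinarith [Real.abs_sin_le_one p.2, abs_nonneg s]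
    · simp
  have m1 : ‖fderiv ℝ (fderiv ℝ φ) (shear c s p) (s * Real.cos p.2, 1) (s * Real.cos p.2, 1)‖
      ≤ ‖iteratedFDeriv ℝ 2 φ (shear c s p)‖ * (1 + |s|) ^ 2 := by
    have h := (iteratedFDeriv ℝ 2 φ (shear c s p)).le_opNorm
      ![(s * Real.cos p.2, 1), (s * Real.cos p.2, 1)]
    rw [iteratedFDeriv_two_apply, Fin.prod_univ_two, Matrix.cons_val_zero, Matrix.cons_val_one,
      Matrix.cons_val_fin_one, ← sq] at h
    exact h.trans (by gcongr)
  have m2 : ‖fderiv ℝ φ (shear c s p) (-(s * Real.sin p.2), 0)‖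
      ≤ ‖fderiv ℝ φ (shear c s p)‖ * |s| :=
    (ContinuousLinearMap.le_opNorm _ _).trans (by gcongr)
  rw [hKK, pull_apply]
  have m3 := norm_add_le
    (fderiv ℝ (fderiv ℝ φ) (shear c s p) (s * Real.cos p.2, 1) (s * Real.cos p.2, 1))
    (fderiv ℝ φ (shear c s p) (-(s * Real.sin p.2), 0))
  have q0 := norm_nonneg (φ (shear c s p))
  have q1 := norm_nonneg (fderiv ℝ φ (shear c s p))
  have hs := abs_nonneg s
  have q2 : 0 ≤ ‖φ (shear c s p)‖ * (2 * |s| + |s| ^ 2) := by positivity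
  have q3 : 0 ≤ ‖fderiv ℝ φ (shear c s p)‖ * (1 + |s| + |s| ^ 2) := by positivity
  nlinarith

theorem integral_pull_le (c s : ℝ) (φ : Test) :
    (∫ p, ‖pull c s φ p‖) + ∫ p, ‖derivK (derivK (pull c s φ)) p‖
      ≤ (1 + |s|) ^ 2 * sobolev φ := by
  rw [← integral_add (pull c s φ).integrable.norm (derivK (derivK (pull c s φ))).integrable.norm]
  have h := (measurePreserving_shear c s).integral_comp (shear c s).measurableEmbedding
    (fun p => ‖φ p‖ + ‖fderiv ℝ φ p‖ + ‖iteratedFDeriv ℝ 2 φ p‖)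
  rw [sobolev, ← h, ← integral_const_mul]
  refine integral_mono ((pull c s φ).integrable.norm.add
    (derivK (derivK (pull c s φ))).integrable.norm) (Integrable.const_mul ?_ _)
    (norm_derivK_derivK_pull_le c s φ)
  exact ((measurePreserving_shear c s).integrable_comp_emb (shear c s).measurableEmbedding).2
    (integrable_sobolev φ)

/-! ### Fourier modes in the wave number -/

/-- The plane wave `e^{i j k}` times a function of position. -/
def wave (j : ℤ) (γ : ℝ → ℂ) (p : ℝ × ℝ) : ℂ := Complex.exp (Complex.I * j * p.2) * γ p.1

/-- The pairing of a test function with `e^{i j k} γ(r)`. -/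
def mode (j : ℤ) (γ : ℝ → ℂ) (φ : Test) : ℂ := ∫ p, (φ p : ℂ) * wave j γ p

theorem norm_wave (j : ℤ) (γ : ℝ → ℂ) (p : ℝ × ℝ) : ‖wave j γ p‖ = ‖γ p.1‖ := by
  have h : Complex.I * j * p.2 = ((j * p.2 : ℝ) : ℂ) * Complex.I := by
    push_cast
    ring
  rw [wave, norm_mul, h, Complex.norm_exp_ofReal_mul_I, one_mul]

theorem measurable_wave (j : ℤ) {γ : ℝ → ℂ} (hγ : Measurable γ) : Measurable (wave j γ) := by
  unfold wave
  fun_prop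

theorem wave_succ (j : ℤ) (γ : ℝ → ℂ) (p : ℝ × ℝ) :
    wave (j + 1) γ p - wave (j - 1) γ p = 2 * Complex.I * (Real.sin p.2 * wave j γ p) := by
  have h1 : Complex.I * ((j + 1 : ℤ) : ℂ) * p.2 = Complex.I * j * p.2 + p.2 * Complex.I := by
    push_cast
    ring
  have h2 : Complex.I * ((j - 1 : ℤ) : ℂ) * p.2 = Complex.I * j * p.2 + -p.2 * Complex.I := by
    push_cast
    ring
  rw [wave, wave, wave, h1, h2, Complex.exp_add, Complex.exp_add, Complex.ofReal_sin, Complex.sin]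
  linear_combination (-(Complex.exp (Complex.I * j * p.2) * γ p.1)
    * (Complex.exp (-p.2 * Complex.I) - Complex.exp (p.2 * Complex.I))) * Complex.I_sq

variable {γ : ℝ → ℂ} {C : ℝ}

theorem integrable_mode (j : ℤ) (hγ : Measurable γ) (hC : ∀ r, ‖γ r‖ ≤ C) (φ : Test) :
    Integrable fun p => (φ p : ℂ) * wave j γ p :=
  φ.integrable.ofReal.mul_bdd (c := C) (measurable_wave j hγ).aestronglyMeasurable
    (Eventually.of_forall fun p => (norm_wave j γ p).trans_le (hC _))

theorem mode_add (j : ℤ) (hγ : Measurable γ) (hC : ∀ r, ‖γ r‖ ≤ C) (φ ψ : Test) :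
    mode j γ (φ + ψ) = mode j γ φ + mode j γ ψ := by
  rw [mode, mode, mode, ← integral_add (integrable_mode j hγ hC φ) (integrable_mode j hγ hC ψ)]
  refine integral_congr_ae (Eventually.of_forall fun p => ?_)
  have h : (φ + ψ) p = φ p + ψ p := rfl
  simp only [h, Complex.ofReal_add, add_mul]

theorem mode_smul (j : ℤ) (γ : ℝ → ℂ) (a : ℝ) (φ : Test) :
    mode j γ (a • φ) = a * mode j γ φ := by
  rw [mode, mode, ← integral_const_mul]
  refine integral_congr_ae (Eventually.of_forall fun p => ?_)
  have h : (a • φ) p = a * φ p := rfl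
  simp only [h, Complex.ofReal_mul, mul_assoc]

theorem norm_mode_le_integral (j : ℤ) (hC : ∀ r, ‖γ r‖ ≤ C) (φ : Test) :
    ‖mode j γ φ‖ ≤ C * ∫ p, ‖φ p‖ := by
  rw [← integral_const_mul]
  refine norm_integral_le_of_norm_le (φ.integrable.norm.const_mul C)
    (Eventually.of_forall fun p => ?_)
  rw [norm_mul, norm_wave, Complex.norm_real, mul_comm]
  gcongr
  exact hC _

/-- Integration by parts in `k` alone, so no regularity in `r` is required: in the application `γ`
is a step function of `r`. -/
theorem mode_derivK (j : ℤ) (hγ : Measurable γ) (hC : ∀ r, ‖γ r‖ ≤ C) (φ : Test) :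
    mode j γ (derivK φ) = -(Complex.I * j) * mode j γ φ := by
  have h := integral_bilinear_hasLineDerivAt_right_eq_neg_left_of_integrable
    (μ := (volume : Measure (ℝ × ℝ))) (B := ContinuousLinearMap.mul ℝ ℂ) (v := ((0 : ℝ), (1 : ℝ)))
    (f := fun p => (φ p : ℂ)) (f' := fun p => (derivK φ p : ℂ))
    (g := wave j γ) (g' := fun p => Complex.I * j * wave j γ p)
    (integrable_mode j hγ hC (derivK φ))
    (by
      refine ((integrable_mode j hγ hC φ).const_mul (Complex.I * j)).congr
        (Eventually.of_forall fun p => ?_)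
      simp only [ContinuousLinearMap.mul_apply']
      ring)
    (integrable_mode j hγ hC φ)
    (fun p _ => HasDerivAt.ofReal_comp (φ.hasLineDerivAt p (0, 1)))
    (fun p _ => by
      have h1 : HasDerivAt (fun t : ℝ => Complex.I * j * ((p.2 + t : ℝ) : ℂ)) (Complex.I * j) 0 := by
        simpa using (((hasDerivAt_id (0 : ℝ)).const_add p.2).ofReal_comp).const_mul (Complex.I * j)
      have h2 := (h1.cexp).mul_const (γ p.1)
      refine (h2.congr_deriv ?_).congr_of_eventuallyEq (Eventually.of_forall fun t => ?_)
      · rw [add_zero, wave]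
        ring
      · simp [wave])
  simp only [ContinuousLinearMap.mul_apply'] at h
  have e : ∫ p, (φ p : ℂ) * (Complex.I * j * wave j γ p) = Complex.I * j * mode j γ φ := by
    rw [mode, ← integral_const_mul]
    refine integral_congr_ae (Eventually.of_forall fun p => ?_)
    simp only
    ring
  rw [e] at h
  rw [mode, neg_mul, h, neg_neg]

/-- Two k-derivatives give a bound on `j²` times the mode; adding the trivial bound on the mode
itself gives a summable decay that also covers `j = 0`. -/
theorem norm_mode_le (j : ℤ) (hγ : Measurable γ) (hC : ∀ r, ‖γ r‖ ≤ C) (φ : Test) :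
    ‖mode j γ φ‖ ≤ 1 / (1 + (j : ℝ) ^ 2)
      * (C * ((∫ p, ‖φ p‖) + ∫ p, ‖derivK (derivK φ) p‖)) := by
  have h1 := norm_mode_le_integral j hC φ
  have h2 := norm_mode_le_integral j hC (derivK (derivK φ))
  rw [mode_derivK j hγ hC, mode_derivK j hγ hC, norm_mul, norm_mul, norm_neg, norm_mul,
    Complex.norm_I, one_mul, Complex.norm_intCast, ← mul_assoc, abs_mul_abs_self] at h2
  rw [div_mul_eq_mul_div, one_mul, le_div_iff₀ (by positivity)]
  linarith

theorem norm_mode_pull_le (j : ℤ) (hγ : Measurable γ) (hC : ∀ r, ‖γ r‖ ≤ C) (c s : ℝ) (φ : Test) :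
    ‖mode j γ (pull c s φ)‖ ≤ 1 / (1 + (j : ℝ) ^ 2) * (C * ((1 + |s|) ^ 2 * sobolev φ)) := by
  have hC0 : 0 ≤ C := (norm_nonneg _).trans (hC 0)
  refine (norm_mode_le j hγ hC _).trans ?_
  gcongr
  exact integral_pull_le c s φ

theorem mode_succ (j : ℤ) (hγ : Measurable γ) (hC : ∀ r, ‖γ r‖ ≤ C) (φ : Test) :
    mode (j + 1) γ φ - mode (j - 1) γ φ = 2 * Complex.I * mode j γ φ.mulSin := by
  rw [mode, mode, mode, ← integral_sub (integrable_mode _ hγ hC φ) (integrable_mode _ hγ hC φ),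
    ← integral_const_mul]
  refine integral_congr_ae (Eventually.of_forall fun p => ?_)
  simp only [← mul_sub, wave_succ, Test.mulSin_apply, Complex.ofReal_mul]
  ring

theorem mode_shift (j : ℤ) (γ : ℝ → ℂ) (a : ℝ) (φ : Test) :
    mode j (fun r => γ (r + a)) φ = mode j γ (pull (-a) 0 φ) := by
  have h := (measurePreserving_shear a 0).integral_comp (shear a 0).measurableEmbedding
    (fun p => (pull (-a) 0 φ p : ℂ) * wave j γ p)
  rw [mode, mode, ← h]
  refine integral_congr_ae (Eventually.of_forall fun p => ?_)
  simp [wave, pull_apply, shear_apply]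

theorem summable_one_div_one_add_sq : Summable fun j : ℤ => 1 / (1 + (j : ℝ) ^ 2) := by
  refine Summable.of_norm_bounded_eventually (Real.summable_one_div_int_pow.2 one_lt_two) ?_
  have h : ∀ᶠ j : ℤ in cofinite, j ≠ 0 := (Set.finite_singleton (0 : ℤ)).compl_mem_cofinite
  filter_upwards [h] with j hj
  have hj' : (0 : ℝ) < (j : ℝ) ^ 2 := by positivity
  rw [Real.norm_of_nonneg (by positivity)]
  gcongr
  linarith

/-! ### The Wigner transform of a two-point function -/

/-- The two-point function `G(⌊r/ε + m/2⌋, ⌊r/ε - m/2⌋)` at the scaled position `r`. -/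
def wignerMode (G : ℤ → ℤ → ℂ) (ε : ℝ) (m : ℤ) (r : ℝ) : ℂ := G ⌊r / ε + m / 2⌋ ⌊r / ε - m / 2⌋

/-- The Wigner transform of the two-point function `G`, as a distribution. -/
def wignerTransform (G : ℤ → ℤ → ℂ) (ε : ℝ) (φ : Test) : ℂ := ∑' m : ℤ, mode m (wignerMode G ε m) φ

theorem wigner_eq (ν : Obs → ℂ) (ε : ℝ) (φ : Test) :
    wigner ν ε φ = wignerTransform (fun x y => ν (fermiPair x y)) ε φ := by
  simp only [wigner, wignerTransform, mode, wave, wignerMode, mul_assoc]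

theorem measurable_wignerMode (G : ℤ → ℤ → ℂ) (ε : ℝ) (m : ℤ) : Measurable (wignerMode G ε m) := by
  have h1 : Measurable fun q : ℤ × ℤ => G q.1 q.2 := measurable_of_countable _
  have h2 : Measurable fun r : ℝ => (⌊r / ε + m / 2⌋, ⌊r / ε - m / 2⌋) := by fun_prop
  exact h1.comp h2

variable {G : ℤ → ℤ → ℂ}

theorem norm_wignerMode_le (hG : ∀ x y, ‖G x y‖ ≤ C) (ε : ℝ) (m : ℤ) (r : ℝ) :
    ‖wignerMode G ε m r‖ ≤ C := hG _ _

theorem summable_mode (hG : ∀ x y, ‖G x y‖ ≤ C) (ε : ℝ) (φ : Test) :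
    Summable fun m : ℤ => mode m (wignerMode G ε m) φ :=
  Summable.of_norm_bounded (summable_one_div_one_add_sq.mul_right _)
    fun m => norm_mode_le m (measurable_wignerMode G ε m) (norm_wignerMode_le hG ε m) φ

theorem wignerTransform_add (hG : ∀ x y, ‖G x y‖ ≤ C) (ε : ℝ) (φ ψ : Test) :
    wignerTransform G ε (φ + ψ) = wignerTransform G ε φ + wignerTransform G ε ψ := by
  rw [wignerTransform, wignerTransform, wignerTransform,
    ← (summable_mode hG ε φ).tsum_add (summable_mode hG ε ψ)]
  exact tsum_congr fun m =>
    mode_add m (measurable_wignerMode G ε m) (norm_wignerMode_le hG ε m) φ ψ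

theorem wignerTransform_smul (G : ℤ → ℤ → ℂ) (ε a : ℝ) (φ : Test) :
    wignerTransform G ε (a • φ) = a * wignerTransform G ε φ := by
  rw [wignerTransform, wignerTransform, ← tsum_mul_left]
  exact tsum_congr fun m => mode_smul m _ a φ

/-- The sum `∑_j 1 / (1 + j²)` over the integers. -/
def modeSum : ℝ := ∑' j : ℤ, 1 / (1 + (j : ℝ) ^ 2)

theorem modeSum_nonneg : 0 ≤ modeSum := tsum_nonneg fun _ => by positivity

theorem norm_wignerTransform_pull_le (hG : ∀ x y, ‖G x y‖ ≤ C) (ε c s : ℝ) (φ : Test) :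
    ‖wignerTransform G ε (pull c s φ)‖ ≤ modeSum * (C * ((1 + |s|) ^ 2 * sobolev φ)) := by
  rw [modeSum, ← tsum_mul_right]
  exact tsum_of_norm_bounded (summable_one_div_one_add_sq.mul_right _).hasSum
    fun m => norm_mode_pull_le m (measurable_wignerMode G ε m) (norm_wignerMode_le hG ε m) c s φ

/-- With arguments `u + m/2` and `u - m/2`, moving one of them by `±1` and fixing the other changes
`u` by `±1/2` and `m` by `±1`. The identity is exact because the floor commutes with integer shifts.
-/
theorem wignerMode_hopping (G : ℤ → ℤ → ℂ) {ε : ℝ} (hε : ε ≠ 0) (m : ℤ) (r : ℝ) :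
    wignerMode (hopping G) ε m r = -(Complex.I / 2) *
      (wignerMode G ε (m + 1) (r + ε / 2) + wignerMode G ε (m - 1) (r + -(ε / 2))
        - wignerMode G ε (m - 1) (r + ε / 2) - wignerMode G ε (m + 1) (r + -(ε / 2))) := by
  have hp : (r + ε / 2) / ε = r / ε + 1 / 2 := by field_simp
  have hm : (r + -(ε / 2)) / ε = r / ε - 1 / 2 := by field_simp; ring
  simp only [wignerMode, hopping, hp, hm, smul_eq_mul]
  set u := r / ε
  have e1 : u + 1 / 2 + ((m + 1 : ℤ) : ℝ) / 2 = u + m / 2 + (1 : ℤ) := by push_cast; ring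
  have e2 : u + 1 / 2 - ((m + 1 : ℤ) : ℝ) / 2 = u - m / 2 := by push_cast; ring
  have e3 : u - 1 / 2 + ((m - 1 : ℤ) : ℝ) / 2 = u + m / 2 - (1 : ℤ) := by push_cast; ring
  have e4 : u - 1 / 2 - ((m - 1 : ℤ) : ℝ) / 2 = u - m / 2 := by push_cast; ring
  have e5 : u + 1 / 2 + ((m - 1 : ℤ) : ℝ) / 2 = u + m / 2 := by push_cast; ring
  have e6 : u + 1 / 2 - ((m - 1 : ℤ) : ℝ) / 2 = u - m / 2 + (1 : ℤ) := by push_cast; ring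
  have e7 : u - 1 / 2 + ((m + 1 : ℤ) : ℝ) / 2 = u + m / 2 := by push_cast; ring
  have e8 : u - 1 / 2 - ((m + 1 : ℤ) : ℝ) / 2 = u - m / 2 - (1 : ℤ) := by push_cast; ring
  rw [e1, e2, e3, e4, e5, e6, e7, e8]
  simp only [Int.floor_add_intCast, Int.floor_sub_intCast]

/-- The generator of the two-point functions acts on the Wigner transform as a symmetric difference
quotient in position. -/
theorem wignerTransform_hopping (hG : ∀ x y, ‖G x y‖ ≤ C) {ε : ℝ} (hε : ε ≠ 0) (φ : Test) :
    wignerTransform (hopping G) ε φ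
      = wignerTransform G ε (pull (ε / 2) 0 φ.mulSin)
        - wignerTransform G ε (pull (-(ε / 2)) 0 φ.mulSin) := by
  set P := pull (ε / 2) 0 φ with hP
  set Q := pull (-(ε / 2)) 0 φ with hQ
  set γ := wignerMode G ε
  have hγ : ∀ m, Measurable (γ m) := measurable_wignerMode G ε
  have hC : ∀ m r, ‖γ m r‖ ≤ C := norm_wignerMode_le hG ε
  -- The shifts in position are moved onto the test function, with opposite sign.
  have step1 : ∀ m : ℤ, mode m (wignerMode (hopping G) ε m) φ
      = -(Complex.I / 2) * (mode m (γ (m + 1)) Q - mode m (γ (m + 1)) P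
        + (mode m (γ (m - 1)) P - mode m (γ (m - 1)) Q)) := by
    intro m
    have i : ∀ n a, Integrable fun p => (φ p : ℂ) * wave m (fun r => γ n (r + a)) p := fun n a =>
      integrable_mode m ((hγ n).comp (measurable_add_const a)) (fun r => hC n _) φ
    have i' : ∀ n a b, Integrable fun p => (φ p : ℂ) * wave m (fun r => γ n (r + a)) p
        - (φ p : ℂ) * wave m (fun r => γ n (r + b)) p := fun n a b => (i n a).sub (i n b)
    have hP' : P = pull (-(-(ε / 2))) 0 φ := by rw [neg_neg]
    rw [hQ, hP', ← mode_shift, ← mode_shift, ← mode_shift, ← mode_shift, mode, mode, mode, mode,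
      mode, ← integral_sub (i _ _) (i _ _), ← integral_sub (i _ _) (i _ _),
      ← integral_add (i' _ _ _) (i' _ _ _),
      ← integral_const_mul]
    refine integral_congr_ae (Eventually.of_forall fun p => ?_)
    simp only [wave, wignerMode_hopping G hε, γ]
    ring
  have bound : ∀ (a : ℤ) (ψ : Test), Summable fun m : ℤ => mode (m + a) (γ m) ψ := fun a ψ => by
    refine Summable.of_norm_bounded ((summable_one_div_one_add_sq.comp_injective
      (add_left_injective a)).mul_right _) fun m => norm_mode_le (m + a) (hγ m) (hC m) ψ
  have bound1 : ∀ ψ : Test, Summable fun m : ℤ => mode (m - 1) (γ m) ψ := bound (-1)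
  have bound2 := bound 1
  -- Reindexing moves the shift of `m` from the two-point function to the plane wave, where `e^{ik}
  -- - e^{-ik}` produces the factor `sin k`.
  have r1 : Summable (fun m : ℤ => mode m (γ (m + 1)) Q - mode m (γ (m + 1)) P) ∧
      ∑' m : ℤ, (mode m (γ (m + 1)) Q - mode m (γ (m + 1)) P)
        = ∑' m : ℤ, (mode (m - 1) (γ m) Q - mode (m - 1) (γ m) P) := by
    have h := ((bound1 Q).sub (bound1 P))
    have h1 := (Equiv.addRight (1 : ℤ)).summable_iff.2 h
    have h2 := (Equiv.addRight (1 : ℤ)).tsum_eq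
      (fun m : ℤ => mode (m - 1) (γ m) Q - mode (m - 1) (γ m) P)
    simp only [Function.comp_def, Equiv.coe_addRight, add_sub_cancel_right] at h1 h2
    exact ⟨h1, h2⟩
  have r2 : Summable (fun m : ℤ => mode m (γ (m - 1)) P - mode m (γ (m - 1)) Q) ∧
      ∑' m : ℤ, (mode m (γ (m - 1)) P - mode m (γ (m - 1)) Q)
        = ∑' m : ℤ, (mode (m + 1) (γ m) P - mode (m + 1) (γ m) Q) := by
    have h := ((bound2 P).sub (bound2 Q))
    have h1 := (Equiv.subRight (1 : ℤ)).summable_iff.2 h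
    have h2 := (Equiv.subRight (1 : ℤ)).tsum_eq
      (fun m : ℤ => mode (m + 1) (γ m) P - mode (m + 1) (γ m) Q)
    simp only [Function.comp_def, Equiv.subRight_apply, sub_add_cancel] at h1 h2
    exact ⟨h1, h2⟩
  have s1 := (bound1 Q).sub (bound1 P)
  have s2 := (bound2 P).sub (bound2 Q)
  rw [wignerTransform, tsum_congr step1, tsum_mul_left, r1.1.tsum_add r2.1, r1.2, r2.2,
    ← s1.tsum_add s2, pull_mulSin, pull_mulSin, wignerTransform, wignerTransform,
    ← (summable_mode hG ε P.mulSin).tsum_sub (summable_mode hG ε Q.mulSin), ← tsum_mul_left]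
  refine tsum_congr fun m => ?_
  have hp := mode_succ m (hγ m) (hC m) P
  have hq := mode_succ m (hγ m) (hC m) Q
  linear_combination (-(Complex.I / 2)) * hp + Complex.I / 2 * hq
    + (mode m (γ m) Q.mulSin - mode m (γ m) P.mulSin) * Complex.I_sq

/-! ### Differentiation of the Wigner transform along the flow -/

section Derivative

variable {c s : ℝ → ℝ} {a b C C' : ℝ} {G G' : ℝ → ℤ → ℤ → ℂ}

/-- A common compact support for all nearby times is needed for the integrable bound when
differentiating under the integral. -/
theorem exists_compact_pull_eq_zero (hc : Continuous c) (hs : Continuous s) (φ : Test) (τ₀ : ℝ) :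
    ∃ K : Set (ℝ × ℝ), IsCompact K ∧
      ∀ τ ∈ Metric.ball τ₀ 1, ∀ p ∉ K, pull (c τ) (s τ) φ p = 0 := by
  have hf : Continuous fun q : ℝ × (ℝ × ℝ) => (shear (c q.1) (s q.1)).symm q.2 := by
    simp only [shear_symm_apply]
    fun_prop
  refine ⟨(fun q : ℝ × (ℝ × ℝ) => (shear (c q.1) (s q.1)).symm q.2) ''
    (Metric.closedBall τ₀ 1 ×ˢ tsupport φ),
    ((isCompact_closedBall τ₀ 1).prod φ.hasCompactSupport.isCompact).image hf, ?_⟩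
  intro τ hτ p hp
  rw [pull_apply]
  refine image_eq_zero_of_notMem_tsupport fun h => hp ?_
  exact ⟨(τ, shear (c τ) (s τ) p), ⟨Metric.ball_subset_closedBall hτ, h⟩,
    (shear (c τ) (s τ)).symm_apply_apply p⟩

theorem hasDerivAt_mode_pull (hc : ∀ τ, HasDerivAt c a τ) (hs : ∀ τ, HasDerivAt s b τ)
    (hG : ∀ τ x y, ‖G τ x y‖ ≤ C) (hG' : ∀ τ x y, ‖G' τ x y‖ ≤ C')
    (hd : ∀ τ x y, HasDerivAt (fun τ => G τ x y) (G' τ x y) τ) (ε : ℝ) (m : ℤ) (φ : Test) (τ : ℝ) :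
    HasDerivAt (fun τ => mode m (wignerMode (G τ) ε m) (pull (c τ) (s τ) φ))
      (mode m (wignerMode (G' τ) ε m) (pull (c τ) (s τ) φ)
        + mode m (wignerMode (G τ) ε m)
          (pull (c τ) (s τ) (a • ∂_{((1 : ℝ), (0 : ℝ))} φ + b • transport φ))) τ := by
  set φ' := a • ∂_{((1 : ℝ), (0 : ℝ))} φ + b • transport φ with hφ'
  have hcc : Continuous c := continuous_iff_continuousAt.2 fun τ => (hc τ).continuousAt
  have hsc : Continuous s := continuous_iff_continuousAt.2 fun τ => (hs τ).continuousAt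
  obtain ⟨K, hK, hKφ⟩ := exists_compact_pull_eq_zero hcc hsc φ τ
  obtain ⟨K', hK', hKφ'⟩ := exists_compact_pull_eq_zero hcc hsc φ' τ
  obtain ⟨B, hB⟩ := φ.continuous.bounded_above_of_compact_support φ.hasCompactSupport
  obtain ⟨B', hB'⟩ := φ'.continuous.bounded_above_of_compact_support φ'.hasCompactSupport
  have hB0 : 0 ≤ B := (norm_nonneg _).trans (hB 0)
  have hB'0 : 0 ≤ B' := (norm_nonneg _).trans (hB' 0)
  have hint : ∀ τ, Integrable fun p =>
      (pull (c τ) (s τ) φ p : ℂ) * wave m (wignerMode (G τ) ε m) p := fun τ =>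
    integrable_mode m (measurable_wignerMode _ ε m) (norm_wignerMode_le (hG τ) ε m) _
  have hint1 : ∀ τ, Integrable fun p =>
      (pull (c τ) (s τ) φ p : ℂ) * wave m (wignerMode (G' τ) ε m) p := fun τ =>
    integrable_mode m (measurable_wignerMode _ ε m) (norm_wignerMode_le (hG' τ) ε m) _
  have hint2 : ∀ τ, Integrable fun p =>
      (pull (c τ) (s τ) φ' p : ℂ) * wave m (wignerMode (G τ) ε m) p := fun τ =>
    integrable_mode m (measurable_wignerMode _ ε m) (norm_wignerMode_le (hG τ) ε m) _
  have key := hasDerivAt_integral_of_dominated_loc_of_deriv_le (μ := (volume : Measure (ℝ × ℝ)))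
    (x₀ := τ) (s := Metric.ball τ 1) (bound := (K ∪ K').indicator fun _ => B * C' + B' * C)
    (F := fun τ p => (pull (c τ) (s τ) φ p : ℂ) * wave m (wignerMode (G τ) ε m) p)
    (F' := fun τ p => (pull (c τ) (s τ) φ p : ℂ) * wave m (wignerMode (G' τ) ε m) p
      + (pull (c τ) (s τ) φ' p : ℂ) * wave m (wignerMode (G τ) ε m) p)
    (Metric.ball_mem_nhds τ one_pos)
    (Eventually.of_forall fun τ => (hint τ).aestronglyMeasurable) (hint τ)
    ((hint1 τ).add (hint2 τ)).aestronglyMeasurable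
    (Eventually.of_forall fun p τ' hτ' => by
      by_cases hp : p ∈ K ∪ K'
      · rw [Set.indicator_of_mem hp]
        refine (norm_add_le _ _).trans (add_le_add ?_ ?_)
        · rw [norm_mul, norm_wave, Complex.norm_real]
          exact mul_le_mul (hB _) (hG' _ _ _) (norm_nonneg _) hB0
        · rw [norm_mul, norm_wave, Complex.norm_real]
          exact mul_le_mul (hB' _) (hG _ _ _) (norm_nonneg _) hB'0
      · rw [Set.indicator_of_notMem hp, hKφ τ' hτ' p fun h => hp (Or.inl h),
          hKφ' τ' hτ' p fun h => hp (Or.inr h)]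
        simp)
    ((integrable_indicator_iff (hK.union hK').measurableSet).2
      (integrableOn_const (hK.union hK').measure_lt_top.ne))
    (Eventually.of_forall fun p τ' _ => by
      have h1 := (hasDerivAt_pull (hc τ') (hs τ') φ p).ofReal_comp
      have h2 : HasDerivAt (fun τ => wave m (wignerMode (G τ) ε m) p)
          (wave m (wignerMode (G' τ') ε m) p) τ' :=
        HasDerivAt.const_mul _ (hd τ' _ _)
      refine (h1.mul h2).congr_deriv ?_
      rw [hφ']
      ring)
  refine key.2.congr_deriv ?_
  exact integral_add (hint1 τ) (hint2 τ)

/-- The product rule for a moving two-point function and a moving test function. Termwise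
differentiation is allowed because the derivatives of the modes are `O(1 / (1 + m²))`, locally
uniformly in `τ`. -/
theorem hasDerivAt_wignerTransform_pull (hc : ∀ τ, HasDerivAt c a τ) (hs : ∀ τ, HasDerivAt s b τ)
    (hG : ∀ τ x y, ‖G τ x y‖ ≤ C) (hG' : ∀ τ x y, ‖G' τ x y‖ ≤ C')
    (hd : ∀ τ x y, HasDerivAt (fun τ => G τ x y) (G' τ x y) τ) (ε : ℝ) (φ : Test) (τ : ℝ) :
    HasDerivAt (fun τ => wignerTransform (G τ) ε (pull (c τ) (s τ) φ))
      (wignerTransform (G' τ) ε (pull (c τ) (s τ) φ)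
        + wignerTransform (G τ) ε
          (pull (c τ) (s τ) (a • ∂_{((1 : ℝ), (0 : ℝ))} φ + b • transport φ))) τ := by
  set φ' := a • ∂_{((1 : ℝ), (0 : ℝ))} φ + b • transport φ with hφ'
  have hsc : Continuous s := continuous_iff_continuousAt.2 fun τ => (hs τ).continuousAt
  obtain ⟨S, hS⟩ := (isCompact_closedBall τ 1).exists_bound_of_continuousOn hsc.continuousOn
  have hC0 : 0 ≤ C := (norm_nonneg _).trans (hG 0 0 0)
  have hC'0 : 0 ≤ C' := (norm_nonneg _).trans (hG' 0 0 0)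
  have hsob : ∀ φ : Test, 0 ≤ sobolev φ := fun φ => integral_nonneg fun p => by positivity
  have h := hasDerivAt_tsum_of_isPreconnected (t := Metric.ball τ 1) (y₀ := τ) (y := τ)
    (u := fun m : ℤ => 1 / (1 + (m : ℝ) ^ 2) * (C' * ((1 + S) ^ 2 * sobolev φ))
      + 1 / (1 + (m : ℝ) ^ 2) * (C * ((1 + S) ^ 2 * sobolev φ')))
    (g := fun m τ => mode m (wignerMode (G τ) ε m) (pull (c τ) (s τ) φ))
    (g' := fun m τ => mode m (wignerMode (G' τ) ε m) (pull (c τ) (s τ) φ)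
        + mode m (wignerMode (G τ) ε m) (pull (c τ) (s τ) φ'))
    ((summable_one_div_one_add_sq.mul_right _).add (summable_one_div_one_add_sq.mul_right _))
    Metric.isOpen_ball (convex_ball τ 1).isPreconnected
    (fun m τ _ => hasDerivAt_mode_pull hc hs hG hG' hd ε m φ τ)
    (fun m τ' hτ' => by
      have hS' : |s τ'| ≤ S := hS τ' (Metric.ball_subset_closedBall hτ')
      refine (norm_add_le _ _).trans (add_le_add ?_ ?_)
      · refine (norm_mode_pull_le m (measurable_wignerMode _ ε m)
          (norm_wignerMode_le (hG' τ') ε m) _ _ φ).trans ?_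
        have := hsob φ
        gcongr
      · refine (norm_mode_pull_le m (measurable_wignerMode _ ε m)
          (norm_wignerMode_le (hG τ') ε m) _ _ φ').trans ?_
        have := hsob φ'
        gcongr)
    (Metric.mem_ball_self one_pos) (summable_mode (hG τ) ε _) (Metric.mem_ball_self one_pos)
  refine h.congr_deriv ?_
  exact (summable_mode (hG' τ) ε _).tsum_add (summable_mode (hG τ) ε _)

theorem hasDerivAt_wignerTransform_pull_const {G : ℤ → ℤ → ℂ} (hc : ∀ τ, HasDerivAt c a τ)
    (hs : ∀ τ, HasDerivAt s b τ) (hG : ∀ x y, ‖G x y‖ ≤ C) (ε : ℝ) (φ : Test) (τ : ℝ) :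
    HasDerivAt (fun τ => wignerTransform G ε (pull (c τ) (s τ) φ))
      (wignerTransform G ε
        (pull (c τ) (s τ) (a • ∂_{((1 : ℝ), (0 : ℝ))} φ + b • transport φ))) τ := by
  have h := hasDerivAt_wignerTransform_pull (G := fun _ => G) (G' := fun _ _ _ => 0) (C' := 0) hc hs
    (fun _ => hG) (by simp) (fun τ x y => hasDerivAt_const τ (G x y)) ε φ τ
  refine h.congr_deriv ?_
  simp [wignerTransform, mode, wave, wignerMode]

end Derivative

/-! ### Comparison with the transport flow on the Euler scale. -/

theorem norm_taylor_le {q q' q'' : ℝ → ℂ} {x M R : ℝ} (h1 : ∀ y, HasDerivAt q (q' y) y)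
    (h2 : ∀ y, HasDerivAt q' (q'' y) y) (hM : ∀ y, |y - x| ≤ R → ‖q'' y‖ ≤ M) {y : ℝ}
    (hy : |y - x| ≤ R) : ‖q y - q x - (y - x : ℝ) * q' x‖ ≤ M * |y - x| ^ 2 / 2 := by
  have k1 : ∀ δ, |δ| ≤ R → ‖q' (x + δ) - q' x‖ ≤ M * |δ| := by
    intro δ hδ
    have h := norm_le_of_norm_deriv_le_pow (u := fun δ => q' (x + δ) - q' x)
      (u' := fun δ => q'' (x + δ)) (K := M) (S := R) (n := 0) (by simp)
      (fun δ _ => ((h2 (x + δ)).comp_const_add x δ).sub_const _)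
      (fun δ hδ => by simpa using hM (x + δ) (by simpa using hδ)) hδ
    simpa using h
  have h := norm_le_of_norm_deriv_le_pow
    (u := fun δ => q (x + δ) - q x - (δ : ℂ) * q' x)
    (u' := fun δ => q' (x + δ) - q' x) (K := M) (S := R) (n := 1) (by simp)
    (fun δ _ => (((h1 (x + δ)).comp_const_add x δ).sub_const _).sub
      (by simpa using ((hasDerivAt_id δ).ofReal_comp).mul_const (q' x)))
    (fun δ hδ => by simpa using k1 δ hδ) hy
  have e : x + (y - x) = y := by ring
  norm_num [e] at h
  push_cast
  rw [sq_abs]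
  exact h

/-- The symmetric difference quotient of the transported test function approximates its
derivative. -/
theorem norm_wignerTransform_hopping_sub_le {G : ℤ → ℤ → ℂ} {C : ℝ} (hG : ∀ x y, ‖G x y‖ ≤ C)
    {ε : ℝ} (hε : 0 < ε) (s : ℝ) (φ : Test) :
    ‖wignerTransform (hopping G) ε (pull 0 s φ)
        - ε * wignerTransform G ε (pull 0 s (transport φ))‖
      ≤ modeSum * (C * ((1 + |s|) ^ 2
        * sobolev (∂_{((1 : ℝ), (0 : ℝ))} (∂_{((1 : ℝ), (0 : ℝ))} φ.mulSin)))) * ε ^ 2 := by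
  have hq : ∀ (ψ : Test) (x : ℝ), HasDerivAt (fun x => wignerTransform G ε (pull x s ψ))
      (wignerTransform G ε (pull x s (∂_{((1 : ℝ), (0 : ℝ))} ψ))) x := by
    intro ψ x
    have h := hasDerivAt_wignerTransform_pull_const (fun τ => hasDerivAt_id τ)
      (fun τ => hasDerivAt_const τ s) hG ε ψ x
    rwa [one_smul, zero_smul, add_zero] at h
  have hT := fun y (hy : |y - 0| ≤ ε / 2) =>
    norm_taylor_le (x := 0) (R := ε / 2) (hq φ.mulSin) (hq (∂_{((1 : ℝ), (0 : ℝ))} φ.mulSin))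
    (fun y _ => norm_wignerTransform_pull_le hG ε y s _) hy
  have a1 : |ε / 2 - 0| = ε / 2 := by rw [sub_zero, abs_of_pos (by positivity)]
  have a2 : |-(ε / 2) - 0| = ε / 2 := by rw [sub_zero, abs_neg, abs_of_pos (by positivity)]
  have t1 := hT (ε / 2) a1.le
  have t2 := hT (-(ε / 2)) a2.le
  rw [a1] at t1
  rw [a2] at t2
  -- Subtracting the Taylor expansions at `ε/2` and `-ε/2` cancels the constant terms and leaves `ε`
  -- times the derivative. Each remainder is at most `ε²/8` times the second-derivative bound.
  have e : wignerTransform (hopping G) ε (pull 0 s φ)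
      - ε * wignerTransform G ε (pull 0 s (transport φ))
      = (wignerTransform G ε (pull (ε / 2) s φ.mulSin) - wignerTransform G ε (pull 0 s φ.mulSin)
          - (ε / 2 - 0 : ℝ) * wignerTransform G ε (pull 0 s (∂_{((1 : ℝ), (0 : ℝ))} φ.mulSin)))
        - (wignerTransform G ε (pull (-(ε / 2)) s φ.mulSin) - wignerTransform G ε (pull 0 s φ.mulSin)
          - (-(ε / 2) - 0 : ℝ)
            * wignerTransform G ε (pull 0 s (∂_{((1 : ℝ), (0 : ℝ))} φ.mulSin))) := by
    rw [wignerTransform_hopping hG hε.ne', ← pull_mulSin, pull_pull, pull_pull, add_zero, add_zero,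
      zero_add, Test.lineDeriv_mulSin]
    push_cast
    ring
  rw [e]
  have hM : 0 ≤ modeSum * (C * ((1 + |s|) ^ 2
      * sobolev (∂_{((1 : ℝ), (0 : ℝ))} (∂_{((1 : ℝ), (0 : ℝ))} φ.mulSin)))) :=
    (norm_nonneg _).trans (norm_wignerTransform_pull_le hG ε 0 s _)
  refine (norm_sub_le _ _).trans ?_
  nlinarith [sq_nonneg ε]

theorem sobolev_nonneg (φ : Test) : 0 ≤ sobolev φ := integral_nonneg fun p => by positivity

/-- On the Euler scale the Wigner transform is transported along the flow `(r + t sin k, k)`. -/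
theorem norm_wignerTransform_correlation_sub_le (ν : State) {ε : ℝ} (hε : 0 < ε) (t : ℝ)
    (φ : Test) :
    ‖wignerTransform (correlation ν (t / ε)) ε φ
        - wignerTransform (correlation ν 0) ε (pull 0 t φ)‖
      ≤ modeSum * ((1 + |t|) ^ 2
        * sobolev (∂_{((1 : ℝ), (0 : ℝ))} (∂_{((1 : ℝ), (0 : ℝ))} φ.mulSin))) * |t| * ε := by
  set M := modeSum * ((1 + |t|) ^ 2
        * sobolev (∂_{((1 : ℝ), (0 : ℝ))} (∂_{((1 : ℝ), (0 : ℝ))} φ.mulSin)))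
  have hG : ∀ τ x y, ‖correlation ν (τ / ε) x y‖ ≤ 1 := fun τ => norm_correlation_le ν _
  -- Duhamel interpolation: the state evolves up to `τ` and the test function flows for the
  -- remaining time `t - τ`, so the endpoints `τ = t` and `τ = 0` are the two transforms to compare.
  have hd : ∀ τ, HasDerivAt
      (fun τ => wignerTransform (correlation ν (τ / ε)) ε (pull 0 (t - τ) φ))
      ((1 / ε : ℝ) * (wignerTransform (hopping (correlation ν (τ / ε))) ε (pull 0 (t - τ) φ)
        - ε * wignerTransform (correlation ν (τ / ε)) ε (pull 0 (t - τ) (transport φ)))) τ := by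
    intro τ
    have h := hasDerivAt_wignerTransform_pull (c := fun _ => 0) (s := fun τ => t - τ) (a := 0)
      (b := -1) (C := 1) (C' := ‖((1 / ε : ℝ) : ℂ)‖ * (2 * 1))
      (G := fun τ => correlation ν (τ / ε))
      (G' := fun τ x y => ((1 / ε : ℝ) : ℂ) * hopping (correlation ν (τ / ε)) x y)
      (fun τ => hasDerivAt_const τ 0) (fun τ => by simpa using (hasDerivAt_id τ).const_sub t) hG
      (fun τ x y => by
        rw [norm_mul]
        gcongr
        exact norm_hopping_le (hG _ _ _) (hG _ _ _) (hG _ _ _) (hG _ _ _))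
      (fun τ x y => by
        have h1 : HasDerivAt (fun τ : ℝ => τ / ε) (1 / ε) τ := (hasDerivAt_id τ).div_const ε
        have h2 := (hasDerivAt_correlation ν (τ / ε) x y).scomp τ h1
        exact h2) ε φ τ
    refine h.congr_deriv ?_
    have e1 : wignerTransform
        (fun x y => ((1 / ε : ℝ) : ℂ) * hopping (correlation ν (τ / ε)) x y) ε (pull 0 (t - τ) φ)
        = ((1 / ε : ℝ) : ℂ)
          * wignerTransform (hopping (correlation ν (τ / ε))) ε (pull 0 (t - τ) φ) := by
      rw [wignerTransform, wignerTransform, ← tsum_mul_left]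
      refine tsum_congr fun m => ?_
      rw [mode, mode, ← integral_const_mul]
      refine integral_congr_ae (Eventually.of_forall fun p => ?_)
      simp only [wave, wignerMode]
      ring
    have e2 : ((ε : ℝ) : ℂ) ≠ 0 := by exact_mod_cast hε.ne'
    rw [e1, zero_smul, zero_add, pull_smul, wignerTransform_smul]
    push_cast
    field_simp
    ring
  -- The rescaled time costs a factor `1/ε` against the error `ε²` of the symmetric difference.
  have hb : ∀ τ ∈ Set.uIcc 0 t, ‖((1 / ε : ℝ) : ℂ)
      * (wignerTransform (hopping (correlation ν (τ / ε))) ε (pull 0 (t - τ) φ)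
        - ε * wignerTransform (correlation ν (τ / ε)) ε (pull 0 (t - τ) (transport φ)))‖
      ≤ M * ε := by
    intro τ hτ
    have h := norm_wignerTransform_hopping_sub_le (hG τ) hε (t - τ) φ
    have hτ' : |t - τ| ≤ |t| := by
      have := Set.abs_sub_right_of_mem_uIcc hτ
      rwa [sub_zero] at this
    rw [norm_mul, Complex.norm_real, Real.norm_of_nonneg (by positivity), div_mul_eq_mul_div, one_mul,
      div_le_iff₀ hε]
    refine h.trans ?_
    rw [mul_assoc M, ← sq, one_mul]
    have := modeSum_nonneg
    have := sobolev_nonneg (∂_{((1 : ℝ), (0 : ℝ))} (∂_{((1 : ℝ), (0 : ℝ))} φ.mulSin))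
    simp only [M]
    gcongr
  have h := (convex_uIcc 0 t).norm_image_sub_le_of_norm_hasDerivWithin_le
    (fun τ _ => (hd τ).hasDerivWithinAt) hb Set.left_mem_uIcc Set.right_mem_uIcc
  simp only [sub_self, sub_zero, zero_div, pull_zero, Real.norm_eq_abs] at h
  refine h.trans_eq ?_
  ring

/-! ### The limiting distributions -/

section Limit

variable {G : ℝ → ℤ → ℤ → ℂ} {L : Test → ℂ}

theorem limit_add (hG : ∀ ε x y, ‖G ε x y‖ ≤ 1)
    (hL : ∀ φ, Tendsto (fun ε => wignerTransform (G ε) ε φ) (𝓝[>] 0) (𝓝 (L φ))) (φ ψ : Test) :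
    L (φ + ψ) = L φ + L ψ := by
  refine tendsto_nhds_unique (hL _) (((hL φ).add (hL ψ)).congr fun ε => ?_)
  exact (wignerTransform_add (hG ε) ε φ ψ).symm

theorem limit_smul (hL : ∀ φ, Tendsto (fun ε => wignerTransform (G ε) ε φ) (𝓝[>] 0) (𝓝 (L φ)))
    (a : ℝ) (φ : Test) : L (a • φ) = a • L φ := by
  refine tendsto_nhds_unique (hL _) (((hL φ).const_smul a).congr fun ε => ?_)
  rw [wignerTransform_smul]
  exact Complex.real_smul

theorem norm_limit_pull_le (hG : ∀ ε x y, ‖G ε x y‖ ≤ 1)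
    (hL : ∀ φ, Tendsto (fun ε => wignerTransform (G ε) ε φ) (𝓝[>] 0) (𝓝 (L φ))) (c s : ℝ)
    (φ : Test) : ‖L (pull c s φ)‖ ≤ modeSum * ((1 + |s|) ^ 2 * sobolev φ) := by
  refine le_of_tendsto (hL _).norm (Eventually.of_forall fun ε => ?_)
  simpa only [one_mul] using norm_wignerTransform_pull_le (hG ε) ε c s φ

/-- Only derivatives of order at most two enter, so the limit functional is continuous: a
distribution of order at most two. -/
theorem sobolev_ofSupportedIn_le (K : TopologicalSpace.Compacts (ℝ × ℝ))
    (hK : (K : Set (ℝ × ℝ)) ⊆ (⊤ : TopologicalSpace.Opens (ℝ × ℝ)))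
    (φ : ContDiffMapSupportedIn (ℝ × ℝ) ℝ ⊤ K) :
    sobolev (TestFunction.ofSupportedIn hK φ) ≤ 3 * volume.real (K : Set (ℝ × ℝ))
      * (({0, 1, 2} : Finset ℕ).sup fun i => ContDiffMapSupportedIn.seminorm ℝ _ _ ⊤ K i) φ := by
  set S := (({0, 1, 2} : Finset ℕ).sup
    fun i => ContDiffMapSupportedIn.seminorm ℝ (ℝ × ℝ) ℝ ⊤ K i) φ with hS
  have hle : ∀ i ∈ ({0, 1, 2} : Finset ℕ), ∀ p, ‖iteratedFDeriv ℝ i φ p‖ ≤ S := fun i hi p =>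
    (ContDiffMapSupportedIn.norm_iteratedFDeriv_apply_le_seminorm_top ℝ).trans
      (Seminorm.le_finset_sup_apply (p := fun i => ContDiffMapSupportedIn.seminorm ℝ (ℝ × ℝ) ℝ ⊤ K i)
        hi)
  have e : sobolev (TestFunction.ofSupportedIn hK φ)
      = ∫ p, (‖iteratedFDeriv ℝ 0 φ p‖ + ‖iteratedFDeriv ℝ 1 φ p‖ + ‖iteratedFDeriv ℝ 2 φ p‖) := by
    refine integral_congr_ae (Eventually.of_forall fun p => ?_)
    simp only [norm_iteratedFDeriv_zero, norm_iteratedFDeriv_one]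
    rfl
  have h0 : ∀ p ∉ (K : Set (ℝ × ℝ)),
      ‖iteratedFDeriv ℝ 0 φ p‖ + ‖iteratedFDeriv ℝ 1 φ p‖ + ‖iteratedFDeriv ℝ 2 φ p‖ = 0 := by
    intro p hp
    rw [φ.iteratedFDeriv_zero_on_compl hp, φ.iteratedFDeriv_zero_on_compl hp,
      φ.iteratedFDeriv_zero_on_compl hp]
    simp
  rw [e, ← setIntegral_eq_integral_of_forall_compl_eq_zero h0]
  have h := norm_setIntegral_le_of_norm_le_const (μ := volume) (s := (K : Set (ℝ × ℝ)))
    (f := fun p => ‖iteratedFDeriv ℝ 0 φ p‖ + ‖iteratedFDeriv ℝ 1 φ p‖ + ‖iteratedFDeriv ℝ 2 φ p‖)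
    (C := 3 * S) K.isCompact.measure_lt_top (fun p _ => by
      rw [Real.norm_of_nonneg (by positivity)]
      have a0 := hle 0 (by simp) p
      have a1 := hle 1 (by simp) p
      have a2 := hle 2 (by simp) p
      linarith)
  refine (le_abs_self _).trans (h.trans_eq ?_)
  ring

/-- The limit of the Wigner transforms, transported along the flow for a time `t`. -/
def limitDist (hG : ∀ ε x y, ‖G ε x y‖ ≤ 1)
    (hL : ∀ φ, Tendsto (fun ε => wignerTransform (G ε) ε φ) (𝓝[>] 0) (𝓝 (L φ))) (t : ℝ) : Dist :=
  TestFunction.mkCLM ℝ (fun φ : Test => L (pull 0 t φ))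
    (fun φ ψ => by rw [pull_add, limit_add hG hL])
    (fun a φ => by rw [pull_smul, limit_smul hL])
    (fun K hK => by
      let T := ContDiffMapSupportedIn.mkCLMtoNormedSpace ℝ
        (fun φ : ContDiffMapSupportedIn (ℝ × ℝ) ℝ ⊤ K =>
          L (pull 0 t (TestFunction.ofSupportedIn hK φ)))
        (fun φ ψ => limit_add hG hL (pull 0 t (TestFunction.ofSupportedIn hK φ))
          (pull 0 t (TestFunction.ofSupportedIn hK ψ)))
        (fun a φ => limit_smul hL a (pull 0 t (TestFunction.ofSupportedIn hK φ)))
        ⟨{0, 1, 2}, modeSum * ((1 + |t|) ^ 2 * (3 * volume.real (K : Set (ℝ × ℝ)))),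
          by have := modeSum_nonneg; positivity, fun φ => by
            refine (norm_limit_pull_le hG hL 0 t _).trans ?_
            have h := sobolev_ofSupportedIn_le K hK φ
            have := modeSum_nonneg
            calc modeSum * ((1 + |t|) ^ 2 * sobolev (TestFunction.ofSupportedIn hK φ))
                ≤ modeSum * ((1 + |t|) ^ 2 * (3 * volume.real (K : Set (ℝ × ℝ))
                  * (({0, 1, 2} : Finset ℕ).sup
                    fun i => ContDiffMapSupportedIn.seminorm ℝ _ _ ⊤ K i) φ)) := by gcongr
              _ = _ := by ring⟩
      exact T.continuous)

theorem limitDist_apply (hG : ∀ ε x y, ‖G ε x y‖ ≤ 1)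
    (hL : ∀ φ, Tendsto (fun ε => wignerTransform (G ε) ε φ) (𝓝[>] 0) (𝓝 (L φ))) (t : ℝ)
    (φ : Test) : limitDist hG hL t φ = L (pull 0 t φ) := rfl

/-- Derivatives do not pass to pointwise limits, but a second-order Taylor inequality does when its
constant is independent of `ε`; it then gives the derivative of the limit. -/
theorem hasDerivAt_limit_pull (hG : ∀ ε x y, ‖G ε x y‖ ≤ 1)
    (hL : ∀ φ, Tendsto (fun ε => wignerTransform (G ε) ε φ) (𝓝[>] 0) (𝓝 (L φ))) (t : ℝ)
    (φ : Test) : HasDerivAt (fun s => L (pull 0 s φ)) (L (pull 0 t (transport φ))) t := by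
  have hW : ∀ ε (ψ : Test) (s : ℝ), HasDerivAt (fun s => wignerTransform (G ε) ε (pull 0 s ψ))
      (wignerTransform (G ε) ε (pull 0 s (transport ψ))) s := by
    intro ε ψ s
    have h := hasDerivAt_wignerTransform_pull_const (fun τ => hasDerivAt_const τ (0 : ℝ))
      (fun τ => hasDerivAt_id τ) (hG ε) ε ψ s
    rwa [one_smul, zero_smul, zero_add] at h
  -- For `|y - t| ≤ 1` one has `1 + |y| ≤ 2 + |t|`.
  set M := modeSum * ((2 + |t|) ^ 2 * sobolev (transport (transport φ))) with hM
  have key : ∀ s, |s - t| ≤ 1 →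
      ‖L (pull 0 s φ) - L (pull 0 t φ) - (s - t : ℝ) * L (pull 0 t (transport φ))‖
        ≤ M * |s - t| ^ 2 / 2 := by
    intro s hs
    have hlim := (((hL (pull 0 s φ)).sub (hL (pull 0 t φ))).sub
      ((hL (pull 0 t (transport φ))).const_mul ((s - t : ℝ) : ℂ))).norm
    refine le_of_tendsto hlim (Eventually.of_forall fun ε => ?_)
    refine norm_taylor_le (R := 1) (hW ε φ) (hW ε (transport φ)) (fun y hy => ?_) hs
    refine (norm_wignerTransform_pull_le (hG ε) ε 0 y _).trans ?_
    have h1 : |y| ≤ 1 + |t| := by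
      have := abs_add_le (y - t) t
      rw [sub_add_cancel] at this
      linarith
    have h2 := modeSum_nonneg
    have h3 := sobolev_nonneg (transport (transport φ))
    have h4 : 1 + |y| ≤ 2 + |t| := by linarith
    rw [one_mul, hM]
    gcongr
  rw [hasDerivAt_iff_isLittleO]
  refine Asymptotics.IsBigO.trans_isLittleO (g := fun s : ℝ => ‖s - t‖ ^ 2) ?_
    (Asymptotics.isLittleO_pow_sub_sub t one_lt_two)
  refine Asymptotics.IsBigO.of_bound (M / 2) ?_
  filter_upwards [Metric.closedBall_mem_nhds t one_pos] with s hs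
  have h := key s hs
  rw [Complex.real_smul, norm_pow, norm_norm, Real.norm_eq_abs]
  refine h.trans_eq ?_
  ring

/-- A change of variables along the measure-preserving shear moves it from the test function to the
density, with reversed time. -/
theorem represents_shear {g : ℝ × ℝ → ℂ} {T T' : Dist} (hg : Represents g T) (t : ℝ)
    (hT : ∀ φ, T' φ = T (pull 0 t φ)) : Represents (g ∘ shear 0 (-t)) T' := by
  refine ⟨?_, fun φ => ?_⟩
  · rw [← locallyIntegrable_map_homeomorph, (measurePreserving_shear 0 (-t)).map_eq]
    exact hg.1
  · rw [hT, hg.2, ← (measurePreserving_shear 0 (-t)).integral_comp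
      (shear 0 (-t)).measurableEmbedding]
    refine integral_congr_ae (Eventually.of_forall fun p => ?_)
    simp [pull_apply, shear_apply]

theorem transport_equation {g : ℝ × ℝ → ℂ} (hg : ContDiff ℝ 1 g) (t r k : ℝ) :
    deriv (fun s : ℝ => (g ∘ shear 0 (-s)) (r, k)) t
      + (Real.sin k : ℂ) * deriv (fun ρ : ℝ => (g ∘ shear 0 (-t)) (ρ, k)) r = 0 := by
  have hd := (hg.differentiable one_ne_zero (shear 0 (-t) (r, k))).hasFDerivAt
  have h1 : HasDerivAt (fun s => shear 0 (-s) (r, k)) (-Real.sin k, (0 : ℝ)) t := by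
    have h := (((hasDerivAt_id t).neg.mul_const (Real.sin k)).const_add (r + 0)).prodMk
      (hasDerivAt_const t k)
    simpa [shear_apply] using h
  have h2 : HasDerivAt (fun ρ => shear 0 (-t) (ρ, k)) (1, (0 : ℝ)) r :=
    (((hasDerivAt_id r).add_const 0).add_const (-t * Real.sin k)).prodMk (hasDerivAt_const r k)
  have d1 := (HasFDerivAt.comp_hasDerivAt t hd h1).deriv
  have d2 := (HasFDerivAt.comp_hasDerivAt r hd h2).deriv
  have e : (-Real.sin k, (0 : ℝ)) = (-Real.sin k) • ((1 : ℝ), (0 : ℝ)) := by simp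
  have d1' : deriv (fun s : ℝ => (g ∘ shear 0 (-s)) (r, k)) t = _ := d1
  have d2' : deriv (fun ρ : ℝ => (g ∘ shear 0 (-t)) (ρ, k)) r = _ := d2
  rw [d1', d2', e, map_smul, Complex.real_smul]
  push_cast
  ring

end Limit

end HardCore

end

theorem proposition2 (ω : ℝ → HardCore.State)
    (hlim : ∀ φ : HardCore.Test, ∃ L : ℂ,
      Tendsto (fun ε : ℝ => HardCore.wigner (fun A => (ω ε).toFun A) ε φ) (𝓝[>] 0) (𝓝 L)) :
    (∀ (s : ℝ) (x y : ℤ),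
      Tendsto (fun N : ℕ => HardCore.boxEvolution N s (HardCore.fermiPair x y)) atTop
        (𝓝 (HardCore.evolution s (HardCore.fermiPair x y)))) ∧
    ∃ f : ℝ → HardCore.Dist,
      (∀ φ : HardCore.Test,
        Tendsto (fun ε : ℝ => HardCore.wigner (fun A => (ω ε).toFun A) ε φ)
          (𝓝[>] 0) (𝓝 (f 0 φ))) ∧
      (∀ (t : ℝ) (φ : HardCore.Test),
        Tendsto (fun ε : ℝ =>
            HardCore.wigner (fun A => (ω ε).toFun (HardCore.evolution (t / ε) A)) ε φ)
          (𝓝[>] 0) (𝓝 (f t φ))) ∧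
      (∀ (t : ℝ) (φ : HardCore.Test),
        HasDerivAt (fun s : ℝ => f s φ) (f t (HardCore.transport φ)) t) ∧
      (∀ g : ℝ × ℝ → ℂ, HardCore.Represents g (f 0) →
        ∃ F : ℝ → ℝ × ℝ → ℂ, F 0 = g ∧ (∀ t : ℝ, HardCore.Represents (F t) (f t)) ∧
          (ContDiff ℝ 1 g →
            ContDiff ℝ 1 (fun q : ℝ × ℝ × ℝ => F q.1 q.2) ∧
            ∀ t r k : ℝ,
              deriv (fun s : ℝ => F s (r, k)) t
                + (Real.sin k : ℂ) * deriv (fun ρ : ℝ => F t (ρ, k)) r = 0)) := by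
  open HardCore in
  have hW : ∀ ε φ, wigner (fun A => (ω ε).toFun A) ε φ
      = wignerTransform (correlation (ω ε) 0) ε φ := fun ε φ => by
    rw [wigner_eq]
    congr 1
    funext x y
    rw [correlation, evolution_zero]
  -- The limits are given separately for each test function; linearity and continuity of `L` come
  -- from the uniform bounds.
  choose L hL using hlim
  simp only [hW] at hL
  have hG : ∀ ε x y, ‖correlation (ω ε) 0 x y‖ ≤ 1 := fun ε => norm_correlation_le (ω ε) 0
  refine ⟨tendsto_evolution, limitDist hG hL, fun φ => ?_, fun t φ => ?_,
    fun t φ => hasDerivAt_limit_pull hG hL t φ,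
    fun g hg => ⟨fun t => g ∘ shear 0 (-t), ?_, fun t => ?_, fun hg' => ⟨?_, ?_⟩⟩⟩
  · simp only [hW, limitDist_apply, pull_zero]
    exact hL φ
  · simp only [limitDist_apply, wigner_eq]
    -- The evolved transform differs by `O(ε)` from the initial one tested on the sheared function,
    -- and the limit of the latter exists by hypothesis.
    have h0 : Tendsto (fun ε : ℝ => wignerTransform (correlation (ω ε) (t / ε)) ε φ
        - wignerTransform (correlation (ω ε) 0) ε (pull 0 t φ)) (𝓝[>] 0) (𝓝 0) := by
      have hε : Tendsto (fun ε : ℝ => ε) (𝓝[>] 0) (𝓝 0) := tendsto_nhdsWithin_of_tendsto_nhds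
        tendsto_id
      refine squeeze_zero_norm' ?_ (by simpa only [mul_zero] using hε.const_mul (modeSum *
        ((1 + |t|) ^ 2 * sobolev (∂_{((1 : ℝ), (0 : ℝ))} (∂_{((1 : ℝ), (0 : ℝ))} φ.mulSin))) * |t|))
      filter_upwards [self_mem_nhdsWithin] with ε hε
      exact norm_wignerTransform_correlation_sub_le (ω ε) hε t φ
    have h := h0.add (hL (pull 0 t φ))
    simp only [sub_add_cancel, zero_add] at h
    exact h
  · funext p
    simp [shear_apply]
  · refine represents_shear hg t fun φ => ?_
    rw [limitDist_apply, limitDist_apply, pull_pull, add_zero, zero_add]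
  · have h : ContDiff ℝ 1 fun q : ℝ × ℝ × ℝ => (q.2.1 + 0 + -q.1 * Real.sin q.2.2, q.2.2) := by
      fun_prop
    exact hg'.comp h
  · exact fun t r k => transport_equation hg' t r k
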